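/- Theorem (Deformed Tree Tensor QNN). Let $n\ge 1$ and let $\sigma_0=I,\sigma_1,\sigma_2,\sigma_3$ be the Pauli matrices, with $\sigma_{(i_1,\dots,i_n)}=\sigma_{i_1}\otimes\cdots\otimes\sigma_{i_n}$. Number the qubits $1,\dots,n$ and let $m=\lceil\log_2 n\rceil$. The $n$-qubit deformed tree tensor circuit is $$V_{\mathrm{DTT}}(\boldsymbol\theta)=V_{m+1}\,CX_m\,V_m\cdots CX_1\,V_1 .$$ Here, for $1\le\ell\le m$, $CX_\ell$ is the product of the (commuting) CNOT gates with target qubit $a=(j-1)2^{\ell}+1$ and control qubit $a+2^{\ell-1}$, over all integers $j\ge 1$ for which $a+2^{\ell-1}\le n$. The layer $V_1$ applies a rotation $e^{-i\theta\sigma_2}$ to every qubit and, for $2\le\ell\le m+1$, $V_\ell$ applies a rotation $e^{-i\theta\sigma_2}$ to every qubit that is the target of a gate of $CX_{\ell-1}$. Each rotation has its own real parameter $\theta$, and $\boldsymbol\theta$ is the vector of all of them ($2n-1$ in number). For a density matrix $\rho_{\mathrm{in}}\in\mathbb C^{2^n\times 2^n}$ (positive semidefinite of trace one) put $$f_{\mathrm{DTT}}(\boldsymbol\theta)=\tfrac12+\tfrac12\operatorname{Tr}\big[\sigma_{(3,0,\dots,0)}\,V_{\mathrm{DTT}}(\boldsymbol\theta)\,\rho_{\mathrm{in}}\,V_{\mathrm{DTT}}(\boldsymbol\theta)^\dagger\big],$$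 $$\alpha(\rho_{\mathrm{in}})=\operatorname{Tr}[\sigma_{(1,0,\dots,0)}\rho_{\mathrm{in}}]^2+\operatorname{Tr}[\sigma_{(3,0,\dots,0)}\rho_{\mathrm{in}}]^2 .$$ Then $f_{\mathrm{DTT}}$ is differentiable, and when the parameters are independent and uniformly distributed in $[0,2\pi]$, $\|\nabla_{\boldsymbol\theta}f_{\mathrm{DTT}}\|^2$ is integrable and $$\frac{1+\log_2 n}{4n}\,\alpha(\rho_{\mathrm{in}})\;\le\;\mathbb E_{\boldsymbol\theta}\|\nabla_{\boldsymbol\theta}f_{\mathrm{DTT}}\|^2\;\le\;2n-1 .$$ -/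

import Mathlib

noncomputable section

namespace DTTQNN

open Matrix MeasureTheory ProbabilityTheory

/-- Operators on `n` qubits: `2 ^ n × 2 ^ n` complex matrices, with rows and columns indexed by
bit strings.  Qubits are numbered `0, …, n - 1`; qubit `0` is the first one. -/
abbrev Operator (n : ℕ) : Type := Matrix (Fin n → Fin 2) (Fin n → Fin 2) ℂ

/-- The Pauli matrices `σ₀ = I`, `σ₁ = X`, `σ₂ = Y`, `σ₃ = Z`. -/
def sigma : Fin 4 → Matrix (Fin 2) (Fin 2) ℂ :=
  ![!![1, 0; 0, 1], !![0, 1; 1, 0], !![0, -Complex.I; Complex.I, 0], !![1, 0; 0, -1]]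

/-- The tensor product `A₀ ⊗ ⋯ ⊗ Aₙ₋₁` of one-qubit operators. -/
def tensor {n : ℕ} (A : Fin n → Matrix (Fin 2) (Fin 2) ℂ) : Operator n :=
  Matrix.of fun x y => ∏ q, A q (x q) (y q)

/-- The Pauli string `σ_(i₀, …, iₙ₋₁)`. -/
def pauliString {n : ℕ} (i : Fin n → Fin 4) : Operator n := tensor fun q => sigma (i q)

/-- The one-qubit operator `A` acting on qubit `q`, tensored with the identity elsewhere. -/
def onQubit {n : ℕ} (q : Fin n) (A : Matrix (Fin 2) (Fin 2) ℂ) : Operator n :=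
  tensor (Function.update (fun _ => 1) q A)

/-- The CNOT gate with control `c` and target `t`:
`|0⟩⟨0|` on `c`, plus `|1⟩⟨1|` on `c` together with `σ₁` on `t`. -/
def cnot {n : ℕ} (c t : Fin n) : Operator n :=
  onQubit c (Matrix.single 0 0 1) + onQubit c (Matrix.single 1 1 1) * onQubit t (sigma 1)

open scoped ComplexOrder in
/-- Quantum states are density matrices: positive semidefinite of trace one. -/
structure IsState {n : ℕ} (ρ : Operator n) : Prop where
  posSemidef : ρ.PosSemidef
  trace_eq_one : ρ.trace = 1

/-- The one-qubit rotation `W = exp (-i θ σ₂)`. -/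
def rotation (θ : ℝ) : Matrix (Fin 2) (Fin 2) ℂ :=
  NormedSpace.exp ((-(Complex.I * (θ : ℂ))) • sigma 2)

/-- The number `⌈log₂ n⌉` of CNOT layers. -/
abbrev depth (n : ℕ) : ℕ := Nat.clog 2 n

/-- Qubit `q` is the target of a CNOT gate in the CNOT layer number `j = 0, 1, …`: it heads a block
of `2 ^ (j + 1)` consecutive qubits, and the qubit `q + 2 ^ j` heading the second half of that
block exists (it is then the control). For `n` not a power of `2` the last block of a layer may be
incomplete; if its second half is empty, nothing happens to it in that layer. -/
def IsTarget (n j : ℕ) (q : Fin n) : Prop := 2 ^ (j + 1) ∣ (q : ℕ) ∧ (q : ℕ) + 2 ^ j < n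

instance (n j : ℕ) : DecidablePred (IsTarget n j) := fun q =>
  inferInstanceAs (Decidable (2 ^ (j + 1) ∣ (q : ℕ) ∧ (q : ℕ) + 2 ^ j < n))

/-- Qubit `q` carries a rotation in the rotation layer number `ℓ = 0, 1, …`: every qubit does so in
layer `0`, and in layer `j + 1` exactly the targets of the CNOT layer `j` that precedes it. -/
def HasRotation (n : ℕ) : ℕ → Fin n → Prop
  | 0, _ => True
  | j + 1, q => IsTarget n j q

instance (n ℓ : ℕ) : DecidablePred (HasRotation n ℓ) := fun q =>
  match ℓ with
  | 0 => inferInstanceAs (Decidable True)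
  | j + 1 => inferInstanceAs (Decidable (IsTarget n j q))

/-- The parameters of the circuit: one angle for each rotation gate, a gate being given by its
layer and its qubit. -/
abbrev Param (n : ℕ) : Type :=
  {p : Fin (depth n + 1) × Fin n // HasRotation n p.1 p.2}

/-- The rotation layer number `ℓ`. -/
def rotationLayer {n : ℕ} (θ : EuclideanSpace ℝ (Param n)) (ℓ : Fin (depth n + 1)) : Operator n :=
  tensor fun q => if h : HasRotation n ℓ q then rotation (θ ⟨(ℓ, q), h⟩) else 1

/-- The CNOT layer number `j`. The gates of a layer act on pairwise disjoint pairs of qubits, so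
that their order does not matter. -/
def cnotLayer (n j : ℕ) : Operator n :=
  (List.ofFn fun q : Fin n =>
    if h : IsTarget n j q then cnot ⟨(q : ℕ) + 2 ^ j, h.2⟩ q else 1).prod

/-- The circuit up to and including the rotation layer `ℓ`. -/
def partialCircuit {n : ℕ} (θ : EuclideanSpace ℝ (Param n)) (ℓ : Fin (depth n + 1)) : Operator n :=
  Fin.induction (motive := fun _ => Operator n) (rotationLayer θ 0)
    (fun j U => rotationLayer θ j.succ * cnotLayer n j * U) ℓ

/-- The whole circuit `V_DTT(θ)`: rotation layers and CNOT layers alternate, beginning and ending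
with a rotation layer. -/
def circuit {n : ℕ} (θ : EuclideanSpace ℝ (Param n)) : Operator n :=
  partialCircuit θ (Fin.last (depth n))

/-- The trace of a product of two Hermitian matrices is real: no information is lost in taking the
real parts in the two definitions that follow. -/
theorem trace_mul_im {n : ℕ} {A B : Operator n} (hA : A.IsHermitian) (hB : B.IsHermitian) :
    (A * B).trace.im = 0 := by
  rw [← Complex.conj_eq_iff_im]
  have h := Matrix.trace_conjTranspose (A * B)
  rw [Matrix.conjTranspose_mul, hA.eq, hB.eq, Matrix.trace_mul_comm] at h
  exact h.symm

/-- `f_DTT(θ) = 1/2 + 1/2 Tr[σ_(3,0,…,0) V_DTT(θ) ρ V_DTT(θ)†]`. -/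
def objective {n : ℕ} [NeZero n] (ρ : Operator n) (θ : EuclideanSpace ℝ (Param n)) : ℝ :=
  1 / 2 + 1 / 2 * (pauliString (Pi.single (0 : Fin n) 3) * (circuit θ * ρ * (circuit θ)ᴴ)).trace.re

/-- `α(ρ) = Tr[σ_(1,0,…,0) ρ]² + Tr[σ_(3,0,…,0) ρ]²`. -/
def alpha {n : ℕ} [NeZero n] (ρ : Operator n) : ℝ :=
  (pauliString (Pi.single (0 : Fin n) 1) * ρ).trace.re ^ 2 +
    (pauliString (Pi.single (0 : Fin n) 3) * ρ).trace.re ^ 2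

/-- The law of the parameters: independent angles, each uniform in `[0, 2π]`. -/
def paramLaw (n : ℕ) : Measure (EuclideanSpace ℝ (Param n)) :=
  (Measure.pi fun _ : Param n => cond volume (Set.Icc 0 (2 * Real.pi))).map (WithLp.toLp 2)

end DTTQNN

end

noncomputable section

namespace DTTQNN

open Matrix MeasureTheory ProbabilityTheory

variable {n : ℕ}

/-! ### Tensor products of one-qubit operators -/

variable {n : ℕ}

/-! The argument pulls the observable `sigma 3` on qubit `0` back through the circuit. A rotation of
qubit `0` by `θ` turns the plane of `sigma 1` and `sigma 3` by `2θ` (`rotation_conj_planeOp`). A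
CNOT with target `0` fixes `sigma 1` there and sends `sigma 3` to `sigma 3` on both target and
control. So each CNOT layer keeps the cosine component on qubit `0`, while the sine component
acquires a factor anticommuting with `sigma 2` on another qubit. Such terms form `offSpan`; they
never return, because an operator produced in layer `j` is trivial on all controls of the earlier
layers.

Layer `0` rotates every qubit. Averaging over quarter turns of the qubits other than `0` therefore
kills `offSpan` and leaves `meanField`, a product of sinusoids in the angles of qubit `0`
(`sum_objective_add_quarterShift`). The law of the angles is invariant under these shifts, so by
Cauchy–Schwarz the expected squared gradient is at least that of the averaged function
(`sum_meanField_sq_le`). Each of its `depth n + 1` partial derivatives is a shifted `meanField`,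
whose mean square is `alpha ρ / 2 ^ (depth n + 1)` by independence (`integral_meanField_add_sq`).
The lower bound follows from `log₂ n ≤ depth n` and `2 ^ (depth n + 1) ≤ 4 n`.

For the upper bound, the parameter shift rule writes each partial derivative as a difference of two
values of the objective in `[0, 1]`, and there are at most `2 n - 1` parameters (`card_param_le`).
-/

theorem tensor_mul (A B : Fin n → Matrix (Fin 2) (Fin 2) ℂ) :
    tensor A * tensor B = tensor (A * B) := by
  ext x y
  simp only [tensor, Matrix.mul_apply, Matrix.of_apply, Pi.mul_apply, ← Finset.prod_mul_distrib]
  rw [Finset.prod_univ_sum, Fintype.piFinset_univ]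

theorem tensor_one : tensor (1 : Fin n → Matrix (Fin 2) (Fin 2) ℂ) = 1 := by
  ext x y
  simp only [tensor, Matrix.of_apply, Pi.one_apply, Matrix.one_apply, Finset.prod_boole,
    funext_iff, Finset.mem_univ, true_imp_iff]

theorem conjTranspose_tensor (A : Fin n → Matrix (Fin 2) (Fin 2) ℂ) :
    (tensor A)ᴴ = tensor fun q => (A q)ᴴ := by
  ext x y
  simp [tensor, Matrix.conjTranspose_apply]

theorem tensor_eq_zero {A : Fin n → Matrix (Fin 2) (Fin 2) ℂ} {q : Fin n} (h : A q = 0) :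
    tensor A = 0 := by
  ext x y
  simp only [tensor, Matrix.of_apply, Matrix.zero_apply]
  exact Finset.prod_eq_zero (Finset.mem_univ q) (by simp [h])

theorem tensor_update_add (A : Fin n → Matrix (Fin 2) (Fin 2) ℂ) (q : Fin n)
    (B C : Matrix (Fin 2) (Fin 2) ℂ) :
    tensor (Function.update A q (B + C)) =
      tensor (Function.update A q B) + tensor (Function.update A q C) := by
  ext x y
  simp only [tensor, Matrix.of_apply, Matrix.add_apply]
  rw [← Finset.mul_prod_erase _ _ (Finset.mem_univ q),
    ← Finset.mul_prod_erase _ _ (Finset.mem_univ q),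
    ← Finset.mul_prod_erase _ _ (Finset.mem_univ q)]
  simp only [Function.update_self, Matrix.add_apply, add_mul]
  congr 1 <;> congr 1 <;> refine Finset.prod_congr rfl fun p hp => ?_ <;>
    simp [Function.update_of_ne (Finset.ne_of_mem_erase hp)]

theorem tensor_update_smul (A : Fin n → Matrix (Fin 2) (Fin 2) ℂ) (q : Fin n) (c : ℂ)
    (B : Matrix (Fin 2) (Fin 2) ℂ) :
    tensor (Function.update A q (c • B)) = c • tensor (Function.update A q B) := by
  ext x y
  simp only [tensor, Matrix.of_apply, Matrix.smul_apply]
  rw [← Finset.mul_prod_erase _ _ (Finset.mem_univ q),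
    ← Finset.mul_prod_erase _ _ (Finset.mem_univ q)]
  simp only [Function.update_self, Matrix.smul_apply, smul_eq_mul, mul_assoc]
  congr 2
  refine Finset.prod_congr rfl fun p hp => ?_
  simp [Function.update_of_ne (Finset.ne_of_mem_erase hp)]

/-- `onQubit` as an update of the unit of the ring of families of one-qubit operators. -/
theorem onQubit_eq (q : Fin n) (A : Matrix (Fin 2) (Fin 2) ℂ) :
    onQubit q A = tensor (Function.update 1 q A) := rfl

theorem onQubit_add (q : Fin n) (A B : Matrix (Fin 2) (Fin 2) ℂ) :
    onQubit q (A + B) = onQubit q A + onQubit q B := tensor_update_add _ _ _ _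

theorem onQubit_smul (q : Fin n) (c : ℂ) (A : Matrix (Fin 2) (Fin 2) ℂ) :
    onQubit q (c • A) = c • onQubit q A := tensor_update_smul _ _ _ _

theorem pauliString_single [NeZero n] (i : Fin 4) :
    pauliString (Pi.single (0 : Fin n) i) = onQubit 0 (sigma i) := by
  rw [pauliString, onQubit]
  congr 1
  funext q
  by_cases h : q = 0
  · subst h; simp
  · simp only [Pi.single_eq_of_ne h, Function.update_of_ne h, sigma]
    simp [Matrix.one_fin_two]

/-! ### Conjugation by a CNOT gate -/

/-- The family of one-qubit operators that is `A` on qubit `q` and the identity elsewhere. -/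
abbrev oneAt (q : Fin n) (A : Matrix (Fin 2) (Fin 2) ℂ) : Fin n → Matrix (Fin 2) (Fin 2) ℂ :=
  Function.update 1 q A

/-- The part of a one-qubit operator that commutes with `σ₁`. -/
def commPart (A : Matrix (Fin 2) (Fin 2) ℂ) : Matrix (Fin 2) (Fin 2) ℂ :=
  (1 / 2 : ℂ) • (A + sigma 1 * A * sigma 1)

/-- The part of a one-qubit operator that anticommutes with `σ₁`. -/
def anticommPart (A : Matrix (Fin 2) (Fin 2) ℂ) : Matrix (Fin 2) (Fin 2) ℂ :=
  (1 / 2 : ℂ) • (A - sigma 1 * A * sigma 1)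

theorem commPart_add_anticommPart (A : Matrix (Fin 2) (Fin 2) ℂ) :
    commPart A + anticommPart A = A := by
  rw [commPart, anticommPart, ← smul_add, add_add_sub_cancel, ← two_smul ℂ A, smul_smul]
  norm_num

theorem commPart_sub_anticommPart (A : Matrix (Fin 2) (Fin 2) ℂ) :
    commPart A - anticommPart A = sigma 1 * A * sigma 1 := by
  rw [commPart, anticommPart, ← smul_sub, add_sub_sub_cancel, ← two_smul ℂ, smul_smul]
  norm_num

theorem sigma_one_mul_self : sigma 1 * sigma 1 = 1 := by
  simp [sigma, Matrix.one_fin_two]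

theorem sigma_isHermitian (i : Fin 4) : (sigma i)ᴴ = sigma i := by
  fin_cases i <;> ext a b <;> fin_cases a <;> fin_cases b <;> simp [sigma]

theorem cnot_eq (c t : Fin n) :
    cnot c t = tensor (oneAt c (Matrix.single 0 0 1)) +
      tensor (oneAt c (Matrix.single 1 1 1) * oneAt t (sigma 1)) := by
  rw [cnot, onQubit_eq, onQubit_eq, onQubit_eq, tensor_mul]

theorem conjTranspose_cnot {c t : Fin n} (hct : c ≠ t) : (cnot c t)ᴴ = cnot c t := by
  rw [cnot_eq, Matrix.conjTranspose_add, conjTranspose_tensor, conjTranspose_tensor]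
  congr 2 <;> funext q
  · by_cases h : q = c
    · subst h; simp [Matrix.conjTranspose_single]
    · simp [h]
  · by_cases h : q = c
    · subst h; simp [hct, Matrix.conjTranspose_single]
    · by_cases h' : q = t
      · subst h'; simp [h, sigma_isHermitian]
      · simp [h, h']

theorem tensor_congr {A B : Fin n → Matrix (Fin 2) (Fin 2) ℂ} (h : ∀ q, A q = B q) :
    tensor A = tensor B := by rw [funext h]

theorem single_add_single :
    (Matrix.single 0 0 1 + Matrix.single 1 1 1 : Matrix (Fin 2) (Fin 2) ℂ) = 1 := by
  ext a b; fin_cases a <;> fin_cases b <;> simp [Matrix.single]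

theorem single_sub_single :
    (Matrix.single 0 0 1 + (-1 : ℂ) • Matrix.single 1 1 1 : Matrix (Fin 2) (Fin 2) ℂ) = sigma 3 := by
  ext a b; fin_cases a <;> fin_cases b <;> simp [Matrix.single, sigma]

/-- Conjugation by a CNOT gate of a tensor product that is trivial on the control qubit. -/
theorem cnot_conj_tensor {c t : Fin n} (hct : c ≠ t) {A : Fin n → Matrix (Fin 2) (Fin 2) ℂ}
    (hA : A c = 1) :
    (cnot c t)ᴴ * tensor A * cnot c t = tensor (Function.update A t (commPart (A t))) +
      tensor (Function.update (Function.update A t (anticommPart (A t))) c (sigma 3)) := by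
  set P : Matrix (Fin 2) (Fin 2) ℂ := Matrix.single 0 0 1 with hP
  set Q : Matrix (Fin 2) (Fin 2) ℂ := Matrix.single 1 1 1 with hQ
  have hPP : P * P = P := by simp [hP]
  have hQQ : Q * Q = Q := by simp [hQ]
  -- As `A c = 1`, the mixed terms of the expansion carry the factor `P * Q = 0` or `Q * P = 0` on
  -- the control.
  have hPQ : P * Q = 0 := by simp [hP, hQ]
  have hQP : Q * P = 0 := by simp [hP, hQ]
  have e1 : tensor (oneAt c P * A * oneAt c P) =
      tensor (Function.update A c P) := tensor_congr fun q => by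
    by_cases h : q = c
    · subst h; simp [hA, hPP]
    · simp [h]
  have e2 : tensor (oneAt c P * A * (oneAt c Q *
      oneAt t (sigma 1))) = 0 := tensor_eq_zero (q := c) (by simp [hA, hct, hPQ])
  have e3 : tensor (oneAt c Q * oneAt t (sigma 1) * A *
      oneAt c P) = 0 := tensor_eq_zero (q := c) (by simp [hA, hct, hQP])
  have e4 : tensor (oneAt c Q * oneAt t (sigma 1) * A *
      (oneAt c Q * oneAt t (sigma 1))) =
      tensor (Function.update (Function.update A c Q) t (sigma 1 * A t * sigma 1)) :=
    tensor_congr fun q => by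
      by_cases h : q = c
      · subst h; simp [hA, hct, hQQ]
      · by_cases h' : q = t
        · subst h'; simp [h]
        · simp [h, h']
  rw [conjTranspose_cnot hct, cnot_eq]
  simp only [add_mul, mul_add, tensor_mul]
  rw [e1, e2, e3, e4, add_zero, zero_add]
  have hc : ∀ B C, Function.update (Function.update A t B) c C =
      Function.update (Function.update A c C) t B := fun B C => Function.update_comm hct.symm _ _ _
  -- Both sides are compared after splitting by `P` or `Q` on the control, where `1 = P + Q` and
  -- `sigma 3 = P - Q`; the target carries the sum of the two parts of `A t` with `P`, and their
  -- difference with `Q`.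
  have f1 : tensor (Function.update A t (commPart (A t))) =
      tensor (Function.update (Function.update A t (commPart (A t))) c (P + Q)) :=
    tensor_congr fun q => by
      by_cases h : q = c
      · subst h; simp [hct, hA, hP, hQ, single_add_single]
      · simp [h]
  have f2 : tensor (Function.update A c P) =
      tensor (Function.update (Function.update A c P) t (commPart (A t) + anticommPart (A t))) := by
    rw [commPart_add_anticommPart]
    congr 1
    simp [hct.symm]
  rw [f1, f2, ← commPart_sub_anticommPart, ← single_sub_single, ← hP, ← hQ, sub_eq_add_neg,
    ← neg_one_smul ℂ (anticommPart (A t))]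
  simp only [tensor_update_add, tensor_update_smul]
  simp only [hc]
  abel

/-! ### Rotations -/

/-- The operator `-i σ₂`, the rotation by `π / 2`. -/
def quarterTurn : Matrix (Fin 2) (Fin 2) ℂ := !![0, -1; 1, 0]

theorem quarterTurn_mul_self : quarterTurn * quarterTurn = -1 := by
  ext a b; fin_cases a <;> fin_cases b <;> simp [quarterTurn]

theorem rotation_eq (θ : ℝ) :
    rotation θ = !![(Real.cos θ : ℂ), -(Real.sin θ : ℂ); (Real.sin θ : ℂ), (Real.cos θ : ℂ)] := by
  let _ : NormedRing (Matrix (Fin 2) (Fin 2) ℂ) := Matrix.linftyOpNormedRing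
  -- `F` sends `i` to `quarterTurn`; being a continuous algebra homomorphism it commutes with `exp`,
  -- so the rotation is the image of `exp (iθ)`.
  set F : ℂ →ₐ[ℝ] Matrix (Fin 2) (Fin 2) ℂ := Complex.liftAux quarterTurn quarterTurn_mul_self
  have hF : Continuous F := F.toLinearMap.continuous_of_finiteDimensional
  have hval : ∀ z : ℂ, F z = !![(z.re : ℂ), -(z.im : ℂ); (z.im : ℂ), (z.re : ℂ)] := fun z => by
    rw [Complex.liftAux_apply]
    ext a b
    fin_cases a <;> fin_cases b <;> simp [quarterTurn, Matrix.algebraMap_matrix_apply]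
  have harg : (-(Complex.I * (θ : ℂ))) • sigma 2 = F (θ * Complex.I) := by
    rw [hval]
    ext a b
    fin_cases a <;> fin_cases b <;> simp [sigma, mul_right_comm]
  have hexp : rotation θ = F (NormedSpace.exp (θ * Complex.I)) := by
    rw [rotation, harg]
    exact (NormedSpace.map_exp F hF _).symm
  rw [hexp, hval, ← Complex.exp_eq_exp_ℂ, Complex.exp_mul_I]
  simp [← Complex.ofReal_cos, ← Complex.ofReal_sin]

theorem rotation_zero : rotation 0 = 1 := by
  rw [rotation_eq]; simp [Matrix.one_fin_two]

/-- Linearity in `(cos t, sin t)` is what makes the objective an explicit trigonometric polynomial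
in each single angle. -/
theorem rotation_add (θ t : ℝ) :
    rotation (θ + t) =
      (Real.cos t : ℂ) • rotation θ + (Real.sin t : ℂ) • rotation (θ + Real.pi / 2) := by
  simp only [rotation_eq, Real.cos_add, Real.sin_add, Real.cos_pi_div_two, Real.sin_pi_div_two]
  ext a b
  fin_cases a <;> fin_cases b <;> simp <;> ring

theorem rotation_add_pi_div_two (θ : ℝ) :
    rotation (θ + Real.pi / 2) = rotation θ * quarterTurn := by
  simp only [rotation_eq, Real.cos_add_pi_div_two, Real.sin_add_pi_div_two]
  ext a b
  fin_cases a <;> fin_cases b <;> simp [quarterTurn]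

theorem rotation_add_int_mul_two_pi (θ : ℝ) (k : ℤ) :
    rotation (θ + k * (2 * Real.pi)) = rotation θ := by
  simp only [rotation_eq, Real.cos_add_int_mul_two_pi, Real.sin_add_int_mul_two_pi]

theorem rotation_mul_quarterTurn (θ : ℝ) :
    rotation θ * quarterTurn = quarterTurn * rotation θ := by
  rw [rotation_eq]
  ext a b
  fin_cases a <;> fin_cases b <;> simp [quarterTurn]

theorem conjTranspose_rotation_mul_self (θ : ℝ) : (rotation θ)ᴴ * rotation θ = 1 := by
  have h := Complex.cos_sq_add_sin_sq (θ : ℂ)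
  rw [rotation_eq]
  ext a b
  fin_cases a <;> fin_cases b <;>
    simp [Matrix.mul_apply, Fin.sum_univ_two, Matrix.conjTranspose_apply, ← Complex.cos_conj,
      ← Complex.sin_conj] <;>
    first | ring1 | linear_combination h

/-- The unit vector `cos φ σ₁ + sin φ σ₃` of the plane of `σ₁` and `σ₃`. -/
def planeOp (φ : ℝ) : Matrix (Fin 2) (Fin 2) ℂ :=
  (Real.cos φ : ℂ) • sigma 1 + (Real.sin φ : ℂ) • sigma 3

theorem planeOp_zero : planeOp 0 = sigma 1 := by simp [planeOp]

theorem planeOp_pi_div_two : planeOp (Real.pi / 2) = sigma 3 := by simp [planeOp]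

theorem rotation_conj_planeOp (θ φ : ℝ) :
    (rotation θ)ᴴ * planeOp φ * rotation θ = planeOp (φ + 2 * θ) := by
  rw [rotation_eq, planeOp, planeOp, Real.cos_add, Real.sin_add, Real.cos_two_mul', Real.sin_two_mul]
  ext a b
  fin_cases a <;> fin_cases b <;>
    simp [Matrix.mul_apply, Fin.sum_univ_two, Matrix.conjTranspose_apply, ← Complex.cos_conj,
      ← Complex.sin_conj, sigma] <;> ring

/-! ### Operators anticommuting with `σ₂` -/

/-- The one-qubit operator `A` anticommutes with `σ₂`. -/
def AntiY (A : Matrix (Fin 2) (Fin 2) ℂ) : Prop := quarterTurnᴴ * A * quarterTurn = -A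

theorem not_antiY_one : ¬ AntiY 1 := fun h => by
  have := congr_fun (congr_fun h 0) 0
  simp [quarterTurn, Matrix.mul_apply, Fin.sum_univ_two, Matrix.conjTranspose_apply] at this
  norm_num [Complex.ext_iff] at this

theorem antiY_sigma_three : AntiY (sigma 3) := by
  unfold AntiY
  ext a b; fin_cases a <;> fin_cases b <;>
    simp [quarterTurn, sigma, Matrix.mul_apply, Fin.sum_univ_two, Matrix.conjTranspose_apply]

theorem AntiY.smul {A : Matrix (Fin 2) (Fin 2) ℂ} (hA : AntiY A) (c : ℂ) : AntiY (c • A) := by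
  unfold AntiY at *
  rw [Matrix.mul_smul, Matrix.smul_mul, hA, smul_neg]

theorem AntiY.add {A B : Matrix (Fin 2) (Fin 2) ℂ} (hA : AntiY A) (hB : AntiY B) :
    AntiY (A + B) := by
  unfold AntiY at *
  rw [Matrix.mul_add, Matrix.add_mul, hA, hB, neg_add]

/-- Both factors `sigma 1` anticommute with `quarterTurn` and its adjoint, and the two signs cancel.
-/
theorem AntiY.sigma_one_conj {A : Matrix (Fin 2) (Fin 2) ℂ} (hA : AntiY A) :
    AntiY (sigma 1 * A * sigma 1) := by
  have h1 : quarterTurnᴴ * sigma 1 = -(sigma 1 * quarterTurnᴴ) := by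
    ext a b; fin_cases a <;> fin_cases b <;>
      simp [quarterTurn, sigma, Matrix.mul_apply, Fin.sum_univ_two, Matrix.conjTranspose_apply,
        -cons_mul]
  have h2 : sigma 1 * quarterTurn = -(quarterTurn * sigma 1) := by
    ext a b; fin_cases a <;> fin_cases b <;>
      simp [quarterTurn, sigma, Matrix.mul_apply, Fin.sum_univ_two]
  unfold AntiY at *
  calc quarterTurnᴴ * (sigma 1 * A * sigma 1) * quarterTurn
      = (quarterTurnᴴ * sigma 1) * A * (sigma 1 * quarterTurn) := by simp only [mul_assoc]
    _ = sigma 1 * (quarterTurnᴴ * A * quarterTurn) * sigma 1 := by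
      rw [h1, h2]; simp only [neg_mul, mul_neg, neg_neg, mul_assoc]
    _ = -(sigma 1 * A * sigma 1) := by rw [hA, mul_neg, neg_mul]

theorem AntiY.commPart {A : Matrix (Fin 2) (Fin 2) ℂ} (hA : AntiY A) : AntiY (commPart A) :=
  (hA.add hA.sigma_one_conj).smul _

theorem AntiY.anticommPart {A : Matrix (Fin 2) (Fin 2) ℂ} (hA : AntiY A) :
    AntiY (anticommPart A) := by
  have := (hA.add (hA.sigma_one_conj.smul (-1))).smul (1 / 2)
  rwa [neg_one_smul, ← sub_eq_add_neg] at this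

theorem AntiY.rotation_conj {A : Matrix (Fin 2) (Fin 2) ℂ} (hA : AntiY A) (t : ℝ) :
    AntiY ((rotation t)ᴴ * A * rotation t) := by
  have h : quarterTurnᴴ * (rotation t)ᴴ = (rotation t)ᴴ * quarterTurnᴴ := by
    rw [← conjTranspose_mul, ← conjTranspose_mul, rotation_mul_quarterTurn]
  unfold AntiY at *
  calc quarterTurnᴴ * ((rotation t)ᴴ * A * rotation t) * quarterTurn
      = (quarterTurnᴴ * (rotation t)ᴴ) * A * (rotation t * quarterTurn) := by
        simp only [mul_assoc]
    _ = (rotation t)ᴴ * (quarterTurnᴴ * A * quarterTurn) * rotation t := by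
      rw [h, rotation_mul_quarterTurn]; simp only [mul_assoc]
    _ = _ := by rw [hA, mul_neg, neg_mul]

/-! ### Observables that leave qubit `0` -/

theorem control_ne_target {j : ℕ} {q : Fin n} (h : IsTarget n j q) :
    (⟨(q : ℕ) + 2 ^ j, h.2⟩ : Fin n) ≠ q := by
  intro h'
  have := congr_arg Fin.val h'
  simp at this

/-- A control of layer `j` has 2-adic valuation exactly `j`. It is thus no target of that layer, and
it determines the layer. -/
theorem not_dvd_control {j : ℕ} {q : Fin n} (h : IsTarget n j q) :
    ¬ 2 ^ (j + 1) ∣ (q : ℕ) + 2 ^ j := by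
  intro h'
  have h1 := (Nat.dvd_add_right h.1).mp h'
  have := Nat.le_of_dvd (by positivity) h1
  rw [pow_succ] at this
  have : 0 < 2 ^ j := by positivity
  omega

/-- The leftmost gate is the first to act on an observable, so inductions over a layer peel off the
head of the list. -/
theorem list_conj {l : List (Operator n)} {M O : Operator n} :
    (M * l.prod)ᴴ * O * (M * l.prod) = l.prodᴴ * (Mᴴ * O * M) * l.prod := by
  rw [conjTranspose_mul]; simp only [mul_assoc]

/-- `sigma 3` anticommutes with `sigma 1`, so only the second term of `cnot_conj_tensor` survives.
For `sigma 1` or the identity on the target, only the first does. -/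
theorem cnot_conj_onQubit_sigma_three {c t : Fin n} (hct : c ≠ t) :
    (cnot c t)ᴴ * onQubit t (sigma 3) * cnot c t =
      tensor (Function.update (oneAt t (sigma 3)) c (sigma 3)) := by
  have h : sigma 1 * sigma 3 * sigma 1 = -sigma 3 := by
    ext a b; fin_cases a <;> fin_cases b <;> simp [sigma]
  rw [onQubit_eq, cnot_conj_tensor hct (by simp [hct]), tensor_eq_zero (q := t), zero_add]
  · congr 2
    rw [Function.update_self, anticommPart, h, sub_neg_eq_add, ← two_smul ℂ, smul_smul]
    simp
  · rw [Function.update_self, Function.update_self, commPart, h, add_neg_cancel, smul_zero]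

theorem conjTranspose_cnot_mul_self {c t : Fin n} (hct : c ≠ t) :
    (cnot c t)ᴴ * cnot c t = 1 := by
  have h := cnot_conj_tensor hct (A := 1) rfl
  rw [tensor_eq_zero (A := Function.update (Function.update _ t _) c _) (q := t), add_zero,
    tensor_one, mul_one] at h
  · rw [h, ← tensor_one]
    congr 1
    rw [commPart, Pi.one_apply, mul_one, sigma_one_mul_self, ← two_smul ℂ, smul_smul]
    simp
  · rw [Function.update_of_ne hct.symm, Function.update_self, anticommPart, Pi.one_apply, mul_one,
      sigma_one_mul_self, sub_self, smul_zero]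

theorem cnot_conj_onQubit_of_ne {c t q : Fin n} (hct : c ≠ t) (hc : c ≠ q) (ht : t ≠ q)
    (B : Matrix (Fin 2) (Fin 2) ℂ) : (cnot c t)ᴴ * onQubit q B * cnot c t = onQubit q B := by
  rw [onQubit_eq, cnot_conj_tensor hct (by simp [hc]),
    tensor_eq_zero (A := Function.update (Function.update _ t _) c _) (q := t), add_zero]
  · congr 1
    rw [Function.update_of_ne ht, commPart, Pi.one_apply, mul_one, sigma_one_mul_self,
      ← two_smul ℂ, smul_smul]
    simp [ht]
  · rw [Function.update_of_ne hct.symm, Function.update_self, Function.update_of_ne ht,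
      anticommPart, Pi.one_apply, mul_one, sigma_one_mul_self, sub_self, smul_zero]

theorem cnot_conj_onQubit_sigma_one {c t : Fin n} (hct : c ≠ t) :
    (cnot c t)ᴴ * onQubit t (sigma 1) * cnot c t = onQubit t (sigma 1) := by
  rw [onQubit_eq, cnot_conj_tensor hct (by simp [hct]),
    tensor_eq_zero (A := Function.update (Function.update _ t _) c _) (q := t), add_zero]
  · congr 1
    rw [Function.update_self, commPart, sigma_one_mul_self, one_mul, ← two_smul ℂ, smul_smul]
    simp
  · rw [Function.update_of_ne hct.symm, Function.update_self, Function.update_self,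
      anticommPart, sigma_one_mul_self, one_mul, sub_self, smul_zero]

section

variable [NeZero n]

/-- The span of the tensor products that are trivial on `U` and anticommute with `σ₂` on some
qubit other than qubit `0`. -/
def offSpan (U : Set (Fin n)) : Submodule ℂ (Operator n) :=
  Submodule.span ℂ {O | ∃ A : Fin n → Matrix (Fin 2) (Fin 2) ℂ,
    O = tensor A ∧ (∀ q ∈ U, A q = 1) ∧ ∃ q, q ≠ 0 ∧ AntiY (A q)}

theorem tensor_mem_offSpan {U : Set (Fin n)} {A : Fin n → Matrix (Fin 2) (Fin 2) ℂ}
    (h : ∀ q ∈ U, A q = 1) {q : Fin n} (hq : q ≠ 0) (hA : AntiY (A q)) : tensor A ∈ offSpan U :=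
  Submodule.subset_span ⟨A, rfl, h, q, hq, hA⟩

theorem offSpan_anti {U V : Set (Fin n)} (h : V ⊆ U) : offSpan U ≤ offSpan V :=
  Submodule.span_mono fun _ ⟨A, hO, hA, hq⟩ => ⟨A, hO, fun q hq => hA q (h hq), hq⟩

/-- Conjugation maps `offSpan U` to a submodule as soon as it does so on tensor products. -/
theorem conj_mem_of_offSpan {U : Set (Fin n)} {M : Operator n} {T : Submodule ℂ (Operator n)}
    (h : ∀ A : Fin n → Matrix (Fin 2) (Fin 2) ℂ, (∀ q ∈ U, A q = 1) →
      ∀ q, q ≠ 0 → AntiY (A q) → Mᴴ * tensor A * M ∈ T)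
    {O : Operator n} (hO : O ∈ offSpan U) : Mᴴ * O * M ∈ T := by
  induction hO using Submodule.span_induction with
  | mem O hO =>
    obtain ⟨A, rfl, hA, q, hq, hq'⟩ := hO
    exact h A hA q hq hq'
  | zero => simp
  | add O P _ _ hO hP => rw [mul_add, add_mul]; exact T.add_mem hO hP
  | smul c O _ hO => rw [Matrix.mul_smul, Matrix.smul_mul]; exact T.smul_mem c hO

/-- The qubit with the `AntiY` factor is not the control, since the operator is the identity there.
If it is the target, both parts of its factor inherit `AntiY`. Triviality may be lost on `c` and `t`
only. -/
theorem cnot_conj_mem_offSpan {U V : Set (Fin n)} {c t : Fin n} (hct : c ≠ t) (hc : c ∈ U)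
    (hV : ∀ q ∈ V, q ∈ U ∧ q ≠ c ∧ q ≠ t) {O : Operator n} (hO : O ∈ offSpan U) :
    (cnot c t)ᴴ * O * cnot c t ∈ offSpan V := by
  refine conj_mem_of_offSpan (fun A hA q hq hq' => ?_) hO
  have hqc : q ≠ c := fun h => not_antiY_one (by rw [← hA c hc, ← h]; exact hq')
  rw [cnot_conj_tensor hct (hA c hc)]
  refine Submodule.add_mem _ (tensor_mem_offSpan (fun p hp => ?_) hq ?_)
    (tensor_mem_offSpan (fun p hp => ?_) hq ?_)
  · rw [Function.update_of_ne (hV p hp).2.2, hA p (hV p hp).1]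
  · by_cases h : q = t
    · subst h; rw [Function.update_self]; exact hq'.commPart
    · rwa [Function.update_of_ne h]
  · rw [Function.update_of_ne (hV p hp).2.1, Function.update_of_ne (hV p hp).2.2, hA p (hV p hp).1]
  · rw [Function.update_of_ne hqc]
    by_cases h : q = t
    · subst h; rw [Function.update_self]; exact hq'.anticommPart
    · rwa [Function.update_of_ne h]

end

/-! ### CNOT layers -/

/-- The gate of the CNOT layer `j` that has target `q`, if there is one. -/
def layerGate (n j : ℕ) (q : Fin n) : Operator n :=
  if h : IsTarget n j q then cnot ⟨(q : ℕ) + 2 ^ j, h.2⟩ q else 1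

theorem cnotLayer_eq (n j : ℕ) : cnotLayer n j = ((List.finRange n).map (layerGate n j)).prod := by
  rw [cnotLayer, List.ofFn_eq_map]; rfl

/-- The qubits that are still untouched when the gates with targets in `l` remain. -/
def untouched (n j : ℕ) (l : List (Fin n)) : Set (Fin n) :=
  {q | ¬ 2 ^ j ∣ (q : ℕ) ∨ ∃ t ∈ l, IsTarget n j t ∧ (q : ℕ) = t + 2 ^ j}

/-- Distinct targets have distinct controls, and no control is a target, so one gate leaves the
controls of the remaining gates untouched. -/
theorem layerGate_untouched {j : ℕ} {t : Fin n} {l : List (Fin n)} (hl : (t :: l).Nodup)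
    (ht : IsTarget n j t) {q : Fin n} (hq : q ∈ untouched n j l) :
    q ∈ untouched n j (t :: l) ∧ q ≠ ⟨(t : ℕ) + 2 ^ j, ht.2⟩ ∧ q ≠ t := by
  have hd : 2 ^ j ∣ (t : ℕ) := (pow_dvd_pow 2 j.le_succ).trans ht.1
  rcases hq with hq | ⟨s, hs, hs', hq⟩
  · refine ⟨Or.inl hq, ?_, ?_⟩
    · rintro rfl
      exact hq (Dvd.dvd.add hd dvd_rfl)
    · rintro rfl
      exact hq hd
  · refine ⟨Or.inr ⟨s, List.mem_cons_of_mem _ hs, hs', hq⟩, ?_, ?_⟩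
    · rintro rfl
      have : (t : ℕ) = s := by simpa using hq
      rw [Fin.ext this] at hl
      exact (List.nodup_cons.mp hl).1 hs
    · rintro rfl
      exact not_dvd_control hs' (hq ▸ ht.1)

/-- The qubits that are not multiples of `2 ^ j`. -/
def nonMultiples (n j : ℕ) : Set (Fin n) := {q | ¬ 2 ^ j ∣ (q : ℕ)}

theorem untouched_nil (j : ℕ) : untouched n j [] = nonMultiples n j := by
  simp [untouched, nonMultiples]

theorem untouched_subset (j : ℕ) (l : List (Fin n)) :
    untouched n j l ⊆ nonMultiples n (j + 1) := by
  rintro q (hq | ⟨s, _, hs', hq⟩)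
  · exact fun h => hq ((pow_dvd_pow 2 j.le_succ).trans h)
  · exact fun h => not_dvd_control hs' (hq ▸ h)

section

variable [NeZero n]

theorem control_ne_zero {j : ℕ} {q : Fin n} (h : IsTarget n j q) :
    (⟨(q : ℕ) + 2 ^ j, h.2⟩ : Fin n) ≠ 0 := by
  intro h'
  have := congr_arg Fin.val h'
  simp at this

theorem prod_layerGate_conj_mem_offSpan (j : ℕ) (l : List (Fin n)) (hl : l.Nodup)
    {O : Operator n} (hO : O ∈ offSpan (untouched n j l)) :
    (l.map (layerGate n j)).prodᴴ * O * (l.map (layerGate n j)).prod ∈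
      offSpan (untouched n j []) := by
  induction l generalizing O with
  | nil => simpa using hO
  | cons t l ih =>
    rw [List.map_cons, List.prod_cons, list_conj]
    refine ih (List.nodup_cons.mp hl).2 ?_
    by_cases ht : IsTarget n j t
    · rw [layerGate, dif_pos ht]
      exact cnot_conj_mem_offSpan (control_ne_target ht)
        (Or.inr ⟨t, List.mem_cons_self, ht, rfl⟩) (fun q hq => layerGate_untouched hl ht hq) hO
    · rw [layerGate, dif_neg ht]
      simp only [conjTranspose_one, one_mul, mul_one]
      refine offSpan_anti ?_ hO
      rintro q (hq | ⟨s, hs, hs', hq⟩)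
      · exact Or.inl hq
      · exact Or.inr ⟨s, List.mem_cons_of_mem _ hs, hs', hq⟩

/-- The controls of layer `j` are odd multiples of `2 ^ j`. The operator is trivial on them before
the conjugation, and this is all that the layer uses up. -/
theorem cnotLayer_conj_mem_offSpan (j : ℕ) {O : Operator n}
    (hO : O ∈ offSpan (nonMultiples n (j + 1))) :
    (cnotLayer n j)ᴴ * O * cnotLayer n j ∈ offSpan (nonMultiples n j) := by
  rw [cnotLayer_eq, ← untouched_nil]
  exact prod_layerGate_conj_mem_offSpan j _ (List.nodup_finRange n)
    (offSpan_anti (untouched_subset j _) hO)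

theorem prod_layerGate_conj_sigma_one (j : ℕ) (l : List (Fin n)) :
    (l.map (layerGate n j)).prodᴴ * onQubit 0 (sigma 1) * (l.map (layerGate n j)).prod =
      onQubit 0 (sigma 1) := by
  induction l with
  | nil => simp
  | cons t l ih =>
    rw [List.map_cons, List.prod_cons, list_conj]
    suffices h : (layerGate n j t)ᴴ * onQubit 0 (sigma 1) * layerGate n j t = onQubit 0 (sigma 1) by
      rw [h, ih]
    by_cases ht : IsTarget n j t
    · rw [layerGate, dif_pos ht]
      by_cases h0 : t = 0
      · subst h0; exact cnot_conj_onQubit_sigma_one (control_ne_target ht)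
      · exact cnot_conj_onQubit_of_ne (control_ne_target ht) (control_ne_zero ht) h0 _
    · simp [layerGate, dif_neg ht]

/-- Gates listed before the one with target `0` do not touch qubit `0`. That gate puts `sigma 3` on
its control, and the remaining gates preserve membership in `offSpan`. -/
theorem prod_layerGate_conj_sigma_three {j : ℕ} (h0 : IsTarget n j 0) (l : List (Fin n))
    (hl : l.Nodup) (h0l : 0 ∈ l) :
    (l.map (layerGate n j)).prodᴴ * onQubit 0 (sigma 3) * (l.map (layerGate n j)).prod ∈
      offSpan (nonMultiples n j) := by
  induction l with
  | nil => simp at h0l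
  | cons t l ih =>
    rw [List.map_cons, List.prod_cons, list_conj]
    by_cases ht0 : t = 0
    · subst ht0
      rw [← untouched_nil]
      refine prod_layerGate_conj_mem_offSpan j l (List.nodup_cons.mp hl).2 ?_
      rw [layerGate, dif_pos h0, cnot_conj_onQubit_sigma_three (control_ne_target h0)]
      refine tensor_mem_offSpan (fun q hq => ?_) (control_ne_zero h0) ?_
      · obtain ⟨_, h1, h2⟩ := layerGate_untouched hl h0 hq
        rw [Function.update_of_ne h1, oneAt, Function.update_of_ne h2, Pi.one_apply]
      · rw [Function.update_self]; exact antiY_sigma_three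
    · have h : (layerGate n j t)ᴴ * onQubit 0 (sigma 3) * layerGate n j t =
          onQubit 0 (sigma 3) := by
        by_cases ht : IsTarget n j t
        · rw [layerGate, dif_pos ht]
          exact cnot_conj_onQubit_of_ne (control_ne_target ht) (control_ne_zero ht) ht0 _
        · simp [layerGate, dif_neg ht]
      rw [h]
      exact ih (List.nodup_cons.mp hl).2 ((List.mem_cons.mp h0l).resolve_left (Ne.symm ht0))

/-- The branching: the cosine component stays on qubit `0` as `sigma 1`, the sine component leaves
for `offSpan`. -/
theorem cnotLayer_conj_planeOp {j : ℕ} (h0 : IsTarget n j 0) (φ : ℝ) :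
    (cnotLayer n j)ᴴ * onQubit 0 (planeOp φ) * cnotLayer n j -
      (Real.cos φ : ℂ) • onQubit 0 (sigma 1) ∈ offSpan (nonMultiples n j) := by
  rw [planeOp, onQubit_add, onQubit_smul, onQubit_smul, mul_add, add_mul, Matrix.mul_smul,
    Matrix.smul_mul, Matrix.mul_smul, Matrix.smul_mul, cnotLayer_eq,
    prod_layerGate_conj_sigma_one, add_sub_cancel_left]
  exact Submodule.smul_mem _ _
    (prod_layerGate_conj_sigma_three h0 _ (List.nodup_finRange n) (List.mem_finRange 0))

end

theorem conjTranspose_cnotLayer_mul_self (j : ℕ) : (cnotLayer n j)ᴴ * cnotLayer n j = 1 := by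
  rw [cnotLayer_eq]
  induction List.finRange n with
  | nil => simp
  | cons t l ih =>
    have h : (layerGate n j t)ᴴ * layerGate n j t = 1 := by
      by_cases ht : IsTarget n j t
      · rw [layerGate, dif_pos ht]
        exact conjTranspose_cnot_mul_self (control_ne_target ht)
      · simp [layerGate, dif_neg ht]
    rw [List.map_cons, List.prod_cons, conjTranspose_mul, mul_assoc, ← mul_assoc (layerGate n j t)ᴴ,
      h, one_mul, ih]

/-! ### The circuit -/

/-- The gate of the rotation layer `ℓ` on qubit `q`. -/
def rotationGate (θ : EuclideanSpace ℝ (Param n)) (ℓ : Fin (depth n + 1)) (q : Fin n) :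
    Matrix (Fin 2) (Fin 2) ℂ :=
  if h : HasRotation n ℓ q then rotation (θ ⟨(ℓ, q), h⟩) else 1

theorem exists_rotationGate_eq (θ : EuclideanSpace ℝ (Param n)) (ℓ : Fin (depth n + 1))
    (q : Fin n) : ∃ t, rotationGate θ ℓ q = rotation t := by
  by_cases h : HasRotation n ℓ q
  · exact ⟨_, by rw [rotationGate, dif_pos h]⟩
  · exact ⟨0, by rw [rotationGate, dif_neg h, rotation_zero]⟩

theorem rotationLayer_eq (θ : EuclideanSpace ℝ (Param n)) (ℓ : Fin (depth n + 1)) :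
    rotationLayer θ ℓ = tensor (rotationGate θ ℓ) := rfl

theorem tensor_conj_tensor (W A : Fin n → Matrix (Fin 2) (Fin 2) ℂ) :
    (tensor W)ᴴ * tensor A * tensor W = tensor fun q => (W q)ᴴ * A q * W q := by
  rw [conjTranspose_tensor, tensor_mul, tensor_mul]
  rfl

theorem tensor_conj_onQubit {W : Fin n → Matrix (Fin 2) (Fin 2) ℂ}
    (hW : ∀ q, (W q)ᴴ * W q = 1) (q : Fin n) (B : Matrix (Fin 2) (Fin 2) ℂ) :
    (tensor W)ᴴ * onQubit q B * tensor W = onQubit q ((W q)ᴴ * B * W q) := by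
  rw [onQubit_eq, tensor_conj_tensor, onQubit_eq]
  refine tensor_congr fun p => ?_
  by_cases h : p = q
  · subst h; simp
  · simp [h, hW]

theorem conjTranspose_rotationGate_mul_self (θ : EuclideanSpace ℝ (Param n))
    (ℓ : Fin (depth n + 1)) (q : Fin n) : (rotationGate θ ℓ q)ᴴ * rotationGate θ ℓ q = 1 := by
  obtain ⟨t, ht⟩ := exists_rotationGate_eq θ ℓ q
  rw [ht, conjTranspose_rotation_mul_self]

theorem conjTranspose_rotationLayer_mul_self (θ : EuclideanSpace ℝ (Param n))
    (ℓ : Fin (depth n + 1)) : (rotationLayer θ ℓ)ᴴ * rotationLayer θ ℓ = 1 := by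
  rw [rotationLayer_eq, conjTranspose_tensor, tensor_mul, ← tensor_one]
  exact tensor_congr fun q => conjTranspose_rotationGate_mul_self θ ℓ q

theorem partialCircuit_zero (θ : EuclideanSpace ℝ (Param n)) :
    partialCircuit θ 0 = rotationLayer θ 0 := rfl

theorem partialCircuit_succ (θ : EuclideanSpace ℝ (Param n)) (j : Fin (depth n)) :
    partialCircuit θ j.succ = rotationLayer θ j.succ * cnotLayer n j * partialCircuit θ j.castSucc :=
  rfl

theorem partialCircuit_succ_conj (θ : EuclideanSpace ℝ (Param n)) (j : Fin (depth n))
    (O : Operator n) :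
    (partialCircuit θ j.succ)ᴴ * O * partialCircuit θ j.succ =
      (partialCircuit θ j.castSucc)ᴴ * ((cnotLayer n j)ᴴ *
        ((rotationLayer θ j.succ)ᴴ * O * rotationLayer θ j.succ) * cnotLayer n j) *
          partialCircuit θ j.castSucc := by
  rw [partialCircuit_succ]
  simp only [conjTranspose_mul, mul_assoc]

theorem conjTranspose_partialCircuit_mul_self (θ : EuclideanSpace ℝ (Param n))
    (ℓ : Fin (depth n + 1)) : (partialCircuit θ ℓ)ᴴ * partialCircuit θ ℓ = 1 := by
  induction ℓ using Fin.induction with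
  | zero => exact conjTranspose_rotationLayer_mul_self θ 0
  | succ j ih =>
    have h := partialCircuit_succ_conj θ j 1
    rw [mul_one, mul_one, conjTranspose_rotationLayer_mul_self, mul_one,
      conjTranspose_cnotLayer_mul_self, mul_one, ih] at h
    exact h

theorem partialCircuit_congr {θ η : EuclideanSpace ℝ (Param n)}
    (h : ∀ ℓ, rotationLayer θ ℓ = rotationLayer η ℓ) (ℓ : Fin (depth n + 1)) :
    partialCircuit θ ℓ = partialCircuit η ℓ := by
  induction ℓ using Fin.induction with
  | zero => exact h 0
  | succ j ih => rw [partialCircuit_succ, partialCircuit_succ, h, ih]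

section

variable [NeZero n]

theorem isTarget_zero {j : ℕ} (hj : j < depth n) : IsTarget n j 0 := by
  refine ⟨by simp, ?_⟩
  simpa using (Nat.lt_clog_iff_pow_lt one_lt_two).mp hj

theorem hasRotation_zero (ℓ : Fin (depth n + 1)) : HasRotation n ℓ 0 := by
  induction ℓ using Fin.cases with
  | zero => trivial
  | succ j => exact isTarget_zero j.2

/-- The rotation gate of layer `ℓ` on qubit `0`. -/
def headParam (n : ℕ) [NeZero n] (ℓ : Fin (depth n + 1)) : Param n := ⟨(ℓ, 0), hasRotation_zero ℓ⟩

theorem headParam_injective : Function.Injective (headParam n) := fun _ _ h =>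
  congr_arg (fun p : Param n => p.1.1) h

theorem rotationLayer_conj_planeOp (θ : EuclideanSpace ℝ (Param n)) (ℓ : Fin (depth n + 1))
    (φ : ℝ) : (rotationLayer θ ℓ)ᴴ * onQubit 0 (planeOp φ) * rotationLayer θ ℓ =
      onQubit 0 (planeOp (φ + 2 * θ (headParam n ℓ))) := by
  rw [rotationLayer_eq, tensor_conj_onQubit (conjTranspose_rotationGate_mul_self θ ℓ),
    rotationGate, dif_pos (hasRotation_zero ℓ), rotation_conj_planeOp]
  rfl

theorem rotationLayer_conj_mem_offSpan (θ : EuclideanSpace ℝ (Param n)) (ℓ : Fin (depth n + 1))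
    {U : Set (Fin n)} {O : Operator n} (hO : O ∈ offSpan U) :
    (rotationLayer θ ℓ)ᴴ * O * rotationLayer θ ℓ ∈ offSpan U := by
  refine conj_mem_of_offSpan (fun A hA q hq hq' => ?_) hO
  rw [rotationLayer_eq, tensor_conj_tensor]
  refine tensor_mem_offSpan (fun p hp => ?_) hq ?_
  · rw [hA p hp, mul_one, conjTranspose_rotationGate_mul_self]
  · obtain ⟨t, ht⟩ := exists_rotationGate_eq θ ℓ q
    rw [ht]
    exact hq'.rotation_conj t

/-- The triviality required shrinks in step with the layers still to be undone, and none is needed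
at layer `0`. -/
theorem partialCircuit_conj_mem_offSpan (θ : EuclideanSpace ℝ (Param n)) (ℓ : Fin (depth n + 1))
    {O : Operator n} (hO : O ∈ offSpan (nonMultiples n ℓ)) :
    (partialCircuit θ ℓ)ᴴ * O * partialCircuit θ ℓ ∈ offSpan ∅ := by
  induction ℓ using Fin.induction generalizing O with
  | zero => exact rotationLayer_conj_mem_offSpan θ 0 (offSpan_anti (Set.empty_subset _) hO)
  | succ j ih =>
    rw [partialCircuit_succ_conj]
    exact ih (cnotLayer_conj_mem_offSpan j (rotationLayer_conj_mem_offSpan θ j.succ hO))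

/-- The phase `φ` enters only at the top layer `ℓ`: past a CNOT layer the surviving term is `sigma
1`, of phase `0`. The angle of layer `0` meets no further CNOT layer, hence gives no cosine factor.
-/
theorem partialCircuit_conj_planeOp (θ : EuclideanSpace ℝ (Param n)) (ℓ : Fin (depth n + 1))
    (φ : ℝ) :
    (partialCircuit θ ℓ)ᴴ * onQubit 0 (planeOp φ) * partialCircuit θ ℓ -
      ((∏ k ∈ Finset.Ioc 0 ℓ, Real.cos (2 * θ (headParam n k) + if k = ℓ then φ else 0) : ℝ) : ℂ) •
        onQubit 0 (planeOp (2 * θ (headParam n 0) + if ℓ = 0 then φ else 0)) ∈ offSpan ∅ := by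
  induction ℓ using Fin.induction generalizing φ with
  | zero =>
    rw [partialCircuit_zero, rotationLayer_conj_planeOp]
    simp [add_comm]
  | succ j ih =>
    rw [partialCircuit_succ_conj, rotationLayer_conj_planeOp]
    have h1 := partialCircuit_conj_mem_offSpan θ j.castSucc
      (cnotLayer_conj_planeOp (isTarget_zero j.2) (φ + 2 * θ (headParam n j.succ)))
    have h2 := Submodule.smul_mem _
      (Real.cos (φ + 2 * θ (headParam n j.succ)) : ℂ) (ih 0)
    have h3 : Finset.Ioc 0 j.succ = insert j.succ (Finset.Ioc 0 j.castSucc) := by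
      ext k
      simp only [Finset.mem_Ioc, Finset.mem_insert, Fin.ext_iff, Fin.lt_def, Fin.le_def,
        Fin.val_succ, Fin.val_castSucc, Fin.val_zero]
      omega
    have h4 : ∀ k ∈ Finset.Ioc 0 j.castSucc, k ≠ j.succ := fun k hk h => by
      simp [h, Fin.le_def] at hk
    rw [h3, Finset.prod_insert fun h => h4 _ h rfl, if_pos rfl,
      Finset.prod_congr rfl fun k hk => by rw [if_neg (h4 k hk)], if_neg (Fin.succ_ne_zero j)]
    simp only [ite_self] at h2
    rw [planeOp_zero] at h2
    convert add_mem h1 h2 using 1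
    rw [mul_sub, sub_mul, Matrix.mul_smul, Matrix.smul_mul, smul_sub, smul_smul,
      sub_add_sub_cancel, Complex.ofReal_mul, add_comm φ]

/-! ### Averaging over quarter turns of the qubits other than qubit `0` -/

/-- The shift by `π / 2` of the angles of layer `0` on the qubits `q ≠ 0` with `s q = 1`. -/
def quarterShift (s : Fin n → Fin 2) : EuclideanSpace ℝ (Param n) :=
  WithLp.toLp 2 fun p => if p.1.1 = 0 ∧ p.1.2 ≠ 0 ∧ s p.1.2 = 1 then Real.pi / 2 else 0

/-- The one-qubit gates that amount to `quarterShift s`. -/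
def quarterGate (s : Fin n → Fin 2) (q : Fin n) : Matrix (Fin 2) (Fin 2) ℂ :=
  if q ≠ 0 ∧ s q = 1 then quarterTurn else 1

theorem rotationLayer_zero_add_quarterShift (θ : EuclideanSpace ℝ (Param n)) (s : Fin n → Fin 2) :
    rotationLayer (θ + quarterShift s) 0 = rotationLayer θ 0 * tensor (quarterGate s) := by
  rw [rotationLayer_eq, rotationLayer_eq, tensor_mul]
  refine tensor_congr fun q => ?_
  have h : HasRotation n (0 : Fin (depth n + 1)) q := trivial
  simp only [rotationGate, dif_pos h, Pi.mul_apply, quarterGate, quarterShift, PiLp.add_apply,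
    true_and]
  split_ifs
  · exact rotation_add_pi_div_two _
  · rw [add_zero, mul_one]

theorem rotationLayer_succ_add_quarterShift (θ : EuclideanSpace ℝ (Param n)) (s : Fin n → Fin 2)
    (j : Fin (depth n)) : rotationLayer (θ + quarterShift s) j.succ = rotationLayer θ j.succ := by
  rw [rotationLayer_eq, rotationLayer_eq]
  refine tensor_congr fun q => ?_
  simp [rotationGate, quarterShift]

/-- Layer `0` is the rightmost factor of the circuit, so the shift is a right multiplication and
acts last on the pulled-back observable. -/
theorem partialCircuit_add_quarterShift (θ : EuclideanSpace ℝ (Param n)) (s : Fin n → Fin 2)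
    (ℓ : Fin (depth n + 1)) :
    partialCircuit (θ + quarterShift s) ℓ = partialCircuit θ ℓ * tensor (quarterGate s) := by
  induction ℓ using Fin.induction with
  | zero => exact rotationLayer_zero_add_quarterShift θ s
  | succ j ih =>
    rw [partialCircuit_succ, partialCircuit_succ, rotationLayer_succ_add_quarterShift, ih]
    simp only [mul_assoc]

theorem conjTranspose_quarterTurn_mul_self : quarterTurnᴴ * quarterTurn = 1 := by
  ext a b; fin_cases a <;> fin_cases b <;>
    simp [quarterTurn, Matrix.mul_apply, Fin.sum_univ_two, Matrix.conjTranspose_apply]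

theorem quarterGate_conj_onQubit (s : Fin n → Fin 2) (B : Matrix (Fin 2) (Fin 2) ℂ) :
    (tensor (quarterGate s))ᴴ * onQubit 0 B * tensor (quarterGate s) = onQubit 0 B := by
  rw [tensor_conj_onQubit fun q => ?_]
  · simp [quarterGate]
  · unfold quarterGate
    split_ifs
    · exact conjTranspose_quarterTurn_mul_self
    · simp

/-- On a tensor product the sum over `s` factorizes over the qubits, and the factor of the `AntiY`
qubit is `A q - A q = 0`. -/
theorem sum_quarterGate_conj {O : Operator n} (hO : O ∈ offSpan ∅) :
    ∑ s : Fin n → Fin 2, (tensor (quarterGate s))ᴴ * O * tensor (quarterGate s) = 0 := by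
  induction hO using Submodule.span_induction with
  | mem O hO =>
    obtain ⟨A, rfl, -, q, hq, hA⟩ := hO
    have key : ∑ b : Fin 2, (if q ≠ 0 ∧ b = 1 then quarterTurn else 1)ᴴ * A q *
        (if q ≠ 0 ∧ b = 1 then quarterTurn else 1) = 0 := by
      rw [Fin.sum_univ_two]
      simp only [hq, ne_eq, not_false_eq_true, true_and, zero_ne_one, if_true, if_false,
        conjTranspose_one, one_mul, mul_one]
      rw [hA, add_neg_cancel]
    simp only [tensor_conj_tensor]
    ext x y
    rw [Matrix.sum_apply]
    simp only [tensor, Matrix.of_apply, quarterGate, Matrix.zero_apply]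
    have := Finset.prod_univ_sum (fun _ : Fin n => (Finset.univ : Finset (Fin 2)))
      (fun p b => ((if p ≠ 0 ∧ b = 1 then quarterTurn else 1)ᴴ * A p *
        (if p ≠ 0 ∧ b = 1 then quarterTurn else 1)) (x p) (y p))
    rw [Fintype.piFinset_univ] at this
    rw [← this]
    refine Finset.prod_eq_zero (Finset.mem_univ q) ?_
    rw [← Matrix.sum_apply, key, Matrix.zero_apply]
  | zero => simp
  | add O P _ _ hO hP => simp only [mul_add, add_mul, Finset.sum_add_distrib, hO, hP, add_zero]
  | smul c O _ hO => simp only [Matrix.mul_smul, Matrix.smul_mul, ← Finset.smul_sum, hO, smul_zero]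

/-! ### The objective function -/

theorem objective_eq (ρ : Operator n) (θ : EuclideanSpace ℝ (Param n)) :
    objective ρ θ = 1 / 2 + 1 / 2 *
      ((circuit θ)ᴴ * onQubit 0 (sigma 3) * circuit θ * ρ).trace.re := by
  rw [objective, pauliString_single, mul_assoc (circuit θ)ᴴ, mul_assoc (circuit θ)ᴴ,
    Matrix.trace_mul_comm (circuit θ)ᴴ]
  simp only [mul_assoc]

/-- The phases of the rotations on qubit `0`. -/
def phase (n : ℕ) (k : Fin (depth n + 1)) : ℝ := if k = Fin.last _ then Real.pi / 2 else 0

/-- The average of the objective function over quarter turns, up to an affine map. -/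
def meanField (x z : ℝ) (θ : EuclideanSpace ℝ (Param n)) : ℝ :=
  (∏ k ∈ Finset.Ioc 0 (Fin.last (depth n)), Real.cos (2 * θ (headParam n k) + phase n k)) *
    (Real.cos (2 * θ (headParam n 0) + phase n 0) * x +
      Real.sin (2 * θ (headParam n 0) + phase n 0) * z)

theorem sum_objective_add_quarterShift (ρ : Operator n) (θ : EuclideanSpace ℝ (Param n)) :
    ∑ s : Fin n → Fin 2, objective ρ (θ + quarterShift s) =
      2 ^ n * (1 / 2 + 1 / 2 * meanField (pauliString (Pi.single (0 : Fin n) 1) * ρ).trace.re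
        (pauliString (Pi.single (0 : Fin n) 3) * ρ).trace.re θ) := by
  set c : ℝ := ∏ k ∈ Finset.Ioc 0 (Fin.last (depth n)),
    Real.cos (2 * θ (headParam n k) + phase n k) with hc
  set ψ : ℝ := 2 * θ (headParam n 0) + phase n 0 with hψ
  set r : Operator n := (circuit θ)ᴴ * onQubit 0 (sigma 3) * circuit θ -
    (c : ℂ) • onQubit 0 (planeOp ψ) with hr_def
  -- The observable `sigma 3` is `planeOp (π / 2)`, whence the phase `π / 2` in the last layer.
  have hr : r ∈ offSpan ∅ := by
    have := partialCircuit_conj_planeOp θ (Fin.last (depth n)) (Real.pi / 2)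
    rw [planeOp_pi_div_two] at this
    simp only [eq_comm (a := Fin.last (depth n)) (b := 0)] at this
    exact this
  have hsum : ∑ s : Fin n → Fin 2, (circuit (θ + quarterShift s))ᴴ * onQubit 0 (sigma 3) *
      circuit (θ + quarterShift s) = (2 ^ n : ℂ) • (c : ℂ) • onQubit 0 (planeOp ψ) := by
    have h1 : ∀ s : Fin n → Fin 2, (circuit (θ + quarterShift s))ᴴ * onQubit 0 (sigma 3) *
        circuit (θ + quarterShift s) = (c : ℂ) • onQubit 0 (planeOp ψ) +
          (tensor (quarterGate s))ᴴ * r * tensor (quarterGate s) := fun s => by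
      have : (circuit (θ + quarterShift s)) = circuit θ * tensor (quarterGate s) :=
        partialCircuit_add_quarterShift θ s _
      rw [this, conjTranspose_mul, ← quarterGate_conj_onQubit s (planeOp ψ), ← Matrix.smul_mul,
        ← Matrix.mul_smul, ← add_mul, ← mul_add, hr_def, add_sub_cancel]
      simp only [mul_assoc]
    -- The main term is the same for all `2 ^ n` strings `s`; the bit `s 0` is idle and merely
    -- doubles the count.
    rw [Finset.sum_congr rfl fun s _ => h1 s, Finset.sum_add_distrib, sum_quarterGate_conj hr,
      add_zero, Finset.sum_const, Finset.card_univ, Fintype.card_fun, Fintype.card_fin,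
      Fintype.card_fin, ← Nat.cast_smul_eq_nsmul ℂ]
    norm_num
  simp only [objective_eq]
  rw [Finset.sum_add_distrib, ← Finset.mul_sum, ← Complex.re_sum, ← Matrix.trace_sum,
    ← Finset.sum_mul, hsum, meanField, ← hc, ← hψ, pauliString_single, pauliString_single,
    planeOp, onQubit_add, onQubit_smul, onQubit_smul]
  simp only [Matrix.smul_mul, Matrix.trace_smul, Matrix.add_mul, Matrix.trace_add, smul_eq_mul]
  have h2 : ((2 : ℂ) ^ n) = (((2 : ℝ) ^ n : ℝ) : ℂ) := by push_cast; rfl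
  rw [h2, Complex.re_ofReal_mul, Complex.re_ofReal_mul, Complex.add_re, Complex.re_ofReal_mul,
    Complex.re_ofReal_mul]
  simp
  ring

end

/-! ### Dependence on a single angle -/

theorem single_zero {ι : Type*} [DecidableEq ι] (i : ι) :
    EuclideanSpace.single i (0 : ℝ) = 0 := (PiLp.single_eq_zero_iff 2 i).mpr rfl

/-- The angle `p` occurs in a single gate: the layers below do not see it, and from its layer on the
circuit is linear in that gate. -/
theorem partialCircuit_add_single (θ : EuclideanSpace ℝ (Param n)) (p : Param n) (t : ℝ)
    (ℓ : Fin (depth n + 1)) :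
    partialCircuit (θ + EuclideanSpace.single p t) ℓ =
      if p.1.1 ≤ ℓ then (Real.cos t : ℂ) • partialCircuit θ ℓ +
        (Real.sin t : ℂ) • partialCircuit (θ + EuclideanSpace.single p (Real.pi / 2)) ℓ
      else partialCircuit θ ℓ := by
  have hne : ∀ (r : ℝ) (k : Fin (depth n + 1)), k ≠ p.1.1 →
      rotationLayer (θ + EuclideanSpace.single p r) k = rotationLayer θ k := fun r k hk => by
    refine tensor_congr fun q => ?_
    by_cases hq : HasRotation n k q
    · have : (⟨(k, q), hq⟩ : Param n) ≠ p := by rintro rfl; exact hk rfl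
      simp [hq, this]
    · simp [hq]
  have heq : ∀ r : ℝ, rotationLayer (θ + EuclideanSpace.single p r) p.1.1 =
      tensor (Function.update (rotationGate θ p.1.1) p.1.2 (rotation (θ p + r))) := fun r => by
    refine tensor_congr fun q => ?_
    by_cases hqp : q = p.1.2
    · subst hqp
      have h := p.2
      simp [h]
    · rw [Function.update_of_ne hqp, rotationGate]
      by_cases hq : HasRotation n p.1.1 q
      · have : (⟨(p.1.1, q), hq⟩ : Param n) ≠ p := fun h => hqp (by rw [← h])
        simp [hq, this]
      · simp [hq]
  have hself : tensor (Function.update (rotationGate θ p.1.1) p.1.2 (rotation (θ p))) =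
      rotationLayer θ p.1.1 := by
    have := heq 0
    rw [add_zero] at this
    rw [← this, single_zero, add_zero]
  have hlin : rotationLayer (θ + EuclideanSpace.single p t) p.1.1 =
      (Real.cos t : ℂ) • rotationLayer θ p.1.1 + (Real.sin t : ℂ) •
        rotationLayer (θ + EuclideanSpace.single p (Real.pi / 2)) p.1.1 := by
    rw [heq, heq, rotation_add, tensor_update_add, tensor_update_smul, tensor_update_smul, hself]
  have hlt : ∀ (r : ℝ) (k : Fin (depth n + 1)), k < p.1.1 →
      partialCircuit (θ + EuclideanSpace.single p r) k = partialCircuit θ k := fun r k hk => by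
    induction k using Fin.induction with
    | zero => exact hne r 0 hk.ne
    | succ j ih =>
      rw [partialCircuit_succ, partialCircuit_succ, hne r _ hk.ne,
        ih (j.castSucc_lt_succ.trans hk)]
  split_ifs with h
  · induction ℓ using Fin.induction with
    | zero =>
      have h0 : p.1.1 = 0 := Fin.le_zero_iff.mp h
      rw [h0] at hlin
      exact hlin
    | succ j ih =>
      rcases h.eq_or_lt with h | h
      · rw [partialCircuit_succ, partialCircuit_succ, partialCircuit_succ, ← h, hlin,
          hlt _ _ (h ▸ j.castSucc_lt_succ), hlt _ _ (h ▸ j.castSucc_lt_succ)]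
        simp only [Matrix.add_mul, Matrix.smul_mul]
      · rw [partialCircuit_succ, partialCircuit_succ, partialCircuit_succ, hne _ _ h.ne',
          hne _ _ h.ne', ih (Fin.le_castSucc_iff.mpr h)]
        simp only [Matrix.mul_add, Matrix.mul_smul]
  · exact hlt t ℓ (not_le.mp h)

theorem circuit_add_single (θ : EuclideanSpace ℝ (Param n)) (p : Param n) (t : ℝ) :
    circuit (θ + EuclideanSpace.single p t) = (Real.cos t : ℂ) • circuit θ +
      (Real.sin t : ℂ) • circuit (θ + EuclideanSpace.single p (Real.pi / 2)) := by
  rw [circuit, partialCircuit_add_single, if_pos (Fin.le_last _)]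
  rfl

/-! ### Range of the objective and the parameter shift rule -/

open scoped ComplexOrder in
-- The observable is diagonal with entries `±1`, and the diagonal of a state is a probability
-- vector.
theorem abs_re_trace_onQubit_sigma_three_mul_le {σ : Operator n} (hσ : IsState σ) (q : Fin n) :
    |(onQubit q (sigma 3) * σ).trace.re| ≤ 1 := by
  have hdiag : onQubit q (sigma 3) = Matrix.diagonal fun x : Fin n → Fin 2 => sigma 3 (x q) (x q) := by
    ext x y
    rw [onQubit, tensor, Matrix.of_apply, ← Finset.mul_prod_erase _ _ (Finset.mem_univ q),
      Function.update_self]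
    by_cases h : x = y
    · subst h
      rw [Matrix.diagonal_apply_eq, Finset.prod_eq_one, mul_one]
      intro p hp
      simp [Function.update_of_ne (Finset.ne_of_mem_erase hp)]
    · rw [Matrix.diagonal_apply_ne _ h]
      obtain ⟨p, hp⟩ := Function.ne_iff.mp h
      by_cases hpq : p = q
      · subst hpq
        have : sigma 3 (x p) (y p) = 0 := by
          generalize x p = a at *
          generalize y p = b at *
          fin_cases a <;> fin_cases b <;> simp_all [sigma]
        rw [this, zero_mul]
      · rw [Finset.prod_eq_zero (Finset.mem_erase.mpr ⟨hpq, Finset.mem_univ p⟩), mul_zero]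
        rw [Function.update_of_ne hpq, Matrix.one_apply_ne hp]
  have hnn : ∀ x, 0 ≤ (σ x x).re := fun x => by
    have h : _ := hσ.posSemidef.diag_nonneg (i := x)
    exact (Complex.le_def.mp h).1
  have htr : ∑ x, (σ x x).re = 1 := by
    have := congr_arg Complex.re hσ.trace_eq_one
    rwa [Matrix.trace, Complex.re_sum] at this
  rw [hdiag, Matrix.trace, Complex.re_sum, ← htr]
  refine (Finset.abs_sum_le_sum_abs _ _).trans (Finset.sum_le_sum fun x _ => ?_)
  rw [Matrix.diag_apply, Matrix.diagonal_mul]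
  generalize x q = a
  fin_cases a <;> simp [sigma, abs_of_nonneg (hnn x)]

open scoped ComplexOrder in
theorem isState_circuit_conj {ρ : Operator n} (hρ : IsState ρ) (θ : EuclideanSpace ℝ (Param n)) :
    IsState (circuit θ * ρ * (circuit θ)ᴴ) where
  posSemidef := hρ.posSemidef.mul_mul_conjTranspose_same _
  trace_eq_one := by
    rw [Matrix.trace_mul_comm, ← mul_assoc]
    have : (circuit θ)ᴴ * circuit θ = 1 := conjTranspose_partialCircuit_mul_self θ _
    rw [this, one_mul, hρ.trace_eq_one]

section

variable [NeZero n]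

/-- The objective function is a trigonometric polynomial in twice each angle. -/
theorem exists_objective_add_single_eq (ρ : Operator n) (θ : EuclideanSpace ℝ (Param n))
    (p : Param n) : ∃ a b c : ℝ, ∀ t, objective ρ (θ + EuclideanSpace.single p t) =
      a + b * Real.cos (2 * t) + c * Real.sin (2 * t) := by
  set U := circuit θ
  set V := circuit (θ + EuclideanSpace.single p (Real.pi / 2))
  set g : Operator n → Operator n → ℝ := fun M N =>
    (Mᴴ * onQubit 0 (sigma 3) * N * ρ).trace.re with hg
  -- The coefficients come from the quadratic form with values `g` in `(cos t, sin t)`, rewritten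
  -- with the double angle formulas.
  refine ⟨1 / 2 + 1 / 4 * (g U U + g V V), 1 / 4 * (g U U - g V V), 1 / 4 * (g U V + g V U),
    fun t => ?_⟩
  have key : ((circuit (θ + EuclideanSpace.single p t))ᴴ * onQubit 0 (sigma 3) *
      circuit (θ + EuclideanSpace.single p t) * ρ).trace.re =
      Real.cos t * (Real.cos t * g U U) + Real.cos t * (Real.sin t * g U V) +
        (Real.sin t * (Real.cos t * g V U) + Real.sin t * (Real.sin t * g V V)) := by
    rw [circuit_add_single]
    simp only [conjTranspose_add, conjTranspose_smul, Matrix.add_mul, Matrix.mul_add,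
      Matrix.smul_mul, Matrix.mul_smul, Matrix.trace_add, Matrix.trace_smul, smul_eq_mul,
      Complex.add_re, RCLike.star_def, Complex.conj_ofReal, Complex.re_ofReal_mul, hg]
    ring
  rw [objective_eq, key, Real.cos_two_mul, Real.sin_two_mul]
  linear_combination (1 / 4 * (g U U + g V V) + 1 / 4 * (g V V - g U U)) *
    Real.sin_sq_add_cos_sq t

theorem objective_mem_Icc {ρ : Operator n} (hρ : IsState ρ) (θ : EuclideanSpace ℝ (Param n)) :
    0 ≤ objective ρ θ ∧ objective ρ θ ≤ 1 := by
  have := abs_le.mp (abs_re_trace_onQubit_sigma_three_mul_le (isState_circuit_conj hρ θ) 0)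
  rw [objective, pauliString_single]
  constructor <;> linarith

/-- The parameter shift bound on the partial derivatives of the objective function. -/
theorem abs_deriv_objective_le {ρ : Operator n} (hρ : IsState ρ) (θ : EuclideanSpace ℝ (Param n))
    (p : Param n) : |deriv (fun t => objective ρ (θ + EuclideanSpace.single p t)) 0| ≤ 1 := by
  obtain ⟨a, b, c, h⟩ := exists_objective_add_single_eq ρ θ p
  have hd : HasDerivAt (fun t => objective ρ (θ + EuclideanSpace.single p t)) (2 * c) 0 := by
    rw [funext h]
    have h2 : HasDerivAt (fun t : ℝ => 2 * t) 2 0 := by simpa using (hasDerivAt_id (0 : ℝ)).const_mul 2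
    refine (((h2.cos.const_mul b).const_add a).add (h2.sin.const_mul c)).congr_deriv ?_
    rw [mul_zero, Real.sin_zero, Real.cos_zero]; ring
  -- At `t = ±π/4` the objective equals `a ± c`; the difference `2 * c` of these values is the
  -- derivative at `0`.
  have h1 := objective_mem_Icc hρ (θ + EuclideanSpace.single p (Real.pi / 4))
  have h2 := objective_mem_Icc hρ (θ + EuclideanSpace.single p (-(Real.pi / 4)))
  have e : 2 * (Real.pi / 4) = Real.pi / 2 := by ring
  rw [h, e] at h1
  rw [h, mul_neg, e] at h2
  simp only [Real.cos_neg, Real.sin_neg, Real.cos_pi_div_two, Real.sin_pi_div_two] at h1 h2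
  rw [hd.deriv, abs_le]
  constructor <;> linarith

end

/-! ### Differentiability -/

theorem differentiable_rotationLayer_apply (ℓ : Fin (depth n + 1)) (x y : Fin n → Fin 2) :
    Differentiable ℝ fun θ : EuclideanSpace ℝ (Param n) => rotationLayer θ ℓ x y := by
  have h : ∀ q (a b : Fin 2),
      Differentiable ℝ fun θ : EuclideanSpace ℝ (Param n) => rotationGate θ ℓ q a b := fun q a b => by
    by_cases hq : HasRotation n ℓ q
    · have hp : Differentiable ℝ fun θ : EuclideanSpace ℝ (Param n) => θ ⟨(ℓ, q), hq⟩ := by fun_prop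
      have hc : Differentiable ℝ fun θ : EuclideanSpace ℝ (Param n) =>
          (Real.cos (θ ⟨(ℓ, q), hq⟩) : ℂ) := Complex.ofRealCLM.differentiable.comp hp.cos
      have hs : Differentiable ℝ fun θ : EuclideanSpace ℝ (Param n) =>
          (Real.sin (θ ⟨(ℓ, q), hq⟩) : ℂ) := Complex.ofRealCLM.differentiable.comp hp.sin
      simp only [rotationGate, dif_pos hq, rotation_eq]
      fin_cases a <;> fin_cases b
      exacts [hc, hs.neg, hs, hc]
    · simp only [rotationGate, dif_neg hq]
      exact differentiable_const _
  simp only [rotationLayer_eq, tensor, Matrix.of_apply]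
  refine Finset.induction_on Finset.univ (by simp) fun q S hq ih => ?_
  simp only [Finset.prod_insert hq]
  exact (h q (x q) (y q)).mul ih

theorem differentiable_mul_apply {E : Type*} [NormedAddCommGroup E] [NormedSpace ℝ E]
    {M N : E → Operator n} (hM : ∀ x y, Differentiable ℝ fun e => M e x y)
    (hN : ∀ x y, Differentiable ℝ fun e => N e x y) (x y : Fin n → Fin 2) :
    Differentiable ℝ fun e => (M e * N e) x y := by
  simp only [Matrix.mul_apply]
  exact Differentiable.fun_sum fun z _ => (hM x z).mul (hN z y)

theorem differentiable_partialCircuit_apply (ℓ : Fin (depth n + 1)) (x y : Fin n → Fin 2) :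
    Differentiable ℝ fun θ : EuclideanSpace ℝ (Param n) => partialCircuit θ ℓ x y := by
  induction ℓ using Fin.induction generalizing x y with
  | zero => exact differentiable_rotationLayer_apply 0 x y
  | succ j ih =>
    simp only [partialCircuit_succ]
    have h : ∀ x y, Differentiable ℝ fun θ : EuclideanSpace ℝ (Param n) =>
        (rotationLayer θ j.succ * cnotLayer n j) x y :=
      differentiable_mul_apply (differentiable_rotationLayer_apply j.succ)
        (N := fun _ => cnotLayer n j) fun _ _ => differentiable_const _
    exact differentiable_mul_apply h ih x y

theorem differentiable_objective [NeZero n] (ρ : Operator n) : Differentiable ℝ (objective ρ) := by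
  have hV : ∀ x y, Differentiable ℝ fun θ : EuclideanSpace ℝ (Param n) => circuit θ x y :=
    differentiable_partialCircuit_apply _
  have hVs : ∀ x y, Differentiable ℝ fun θ : EuclideanSpace ℝ (Param n) => (circuit θ)ᴴ x y :=
    fun x y => Complex.conjCLE.differentiable.comp (hV y x)
  have h1 := differentiable_mul_apply (differentiable_mul_apply hV (N := fun _ => ρ)
    fun _ _ => differentiable_const _) hVs
  have h2 : ∀ x y, Differentiable ℝ fun θ : EuclideanSpace ℝ (Param n) =>
      (pauliString (Pi.single (0 : Fin n) 3) * (circuit θ * ρ * (circuit θ)ᴴ)) x y :=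
    differentiable_mul_apply (fun _ _ => differentiable_const _) h1
  have h3 : Differentiable ℝ fun θ : EuclideanSpace ℝ (Param n) =>
      (pauliString (Pi.single (0 : Fin n) 3) * (circuit θ * ρ * (circuit θ)ᴴ)).trace := by
    unfold Matrix.trace Matrix.diag
    exact Differentiable.fun_sum fun x _ => h2 x x
  exact ((Complex.reCLM.differentiable.comp h3).const_mul (1 / 2)).const_add (1 / 2)

theorem norm_gradient_sq {ι : Type*} [Fintype ι] [DecidableEq ι] {f : EuclideanSpace ℝ ι → ℝ}
    (hf : Differentiable ℝ f) (θ : EuclideanSpace ℝ ι) :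
    ‖gradient f θ‖ ^ 2 = ∑ i, deriv (fun t => f (θ + EuclideanSpace.single i t)) 0 ^ 2 := by
  rw [EuclideanSpace.real_norm_sq_eq]
  refine Finset.sum_congr rfl fun i _ => ?_
  congr 1
  have h1 : gradient f θ i = fderiv ℝ f θ (EuclideanSpace.single i 1) := by
    rw [← InnerProductSpace.toDual_symm_apply (𝕜 := ℝ), EuclideanSpace.inner_single_right]
    simp [gradient]
  have h2 : HasDerivAt (fun t : ℝ => θ + t • EuclideanSpace.single i (1 : ℝ))
      (EuclideanSpace.single i 1) 0 := by
    simpa using ((hasDerivAt_id (0 : ℝ)).smul_const (EuclideanSpace.single i (1 : ℝ))).const_add θ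
  have h3 : HasFDerivAt f (fderiv ℝ f θ) (θ + (0 : ℝ) • EuclideanSpace.single i (1 : ℝ)) := by
    rw [zero_smul, add_zero]
    exact (hf θ).hasFDerivAt
  have h4 : (fun t : ℝ => f (θ + EuclideanSpace.single i t)) =
      fun t : ℝ => f (θ + t • EuclideanSpace.single i (1 : ℝ)) := by
    funext t
    congr 2
    ext j
    simp
  rw [h1, h4]
  exact (h3.comp_hasDerivAt 0 h2).deriv.symm

/-! ### The number of parameters -/

theorem card_param_le [NeZero n] : (Fintype.card (Param n) : ℝ) ≤ 2 * n - 1 := by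
  have hn : 0 < n := Nat.pos_of_neZero n
  -- A rotation after a CNOT is coded by the control of that CNOT, which lies in `1, …, n - 1` and
  -- determines the layer; adding `n - 1` places these codes after those of layer `0`.
  let g : Param n → ℕ := fun p =>
    Fin.cases (motive := fun _ => ℕ) (p.1.2 : ℕ) (fun j => n - 1 + (p.1.2 + 2 ^ (j : ℕ))) p.1.1
  have hz : ∀ q h, g ⟨(0, q), h⟩ = q := fun _ _ => rfl
  have hs : ∀ j q h, g ⟨(Fin.succ j, q), h⟩ = n - 1 + (q + 2 ^ (j : ℕ)) := fun _ _ _ => rfl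
  have hpos : ∀ j : ℕ, 0 < 2 ^ j := fun j => by positivity
  have hlt : ∀ p, g p < 2 * n - 1 := by
    rintro ⟨⟨ℓ, q⟩, h⟩
    induction ℓ using Fin.cases with
    | zero => rw [hz]; omega
    | succ j =>
      have := h.2
      rw [hs]
      change (q : ℕ) + 2 ^ (j : ℕ) < n at this
      omega
  have hj : ∀ (i j : ℕ) (q r : Fin n), IsTarget n i q → IsTarget n j r →
      (q : ℕ) + 2 ^ i = r + 2 ^ j → ¬ i < j := fun i j q r hq hr h hij => by
    refine not_dvd_control hq ?_
    rw [h]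
    exact ((pow_dvd_pow 2 (by omega)).trans hr.1).add (pow_dvd_pow 2 hij)
  have hinj : Function.Injective g := by
    rintro ⟨⟨ℓ, q⟩, h⟩ ⟨⟨k, r⟩, h'⟩ he
    induction ℓ using Fin.cases with
    | zero =>
      induction k using Fin.cases with
      | zero => rw [hz, hz] at he; simp [Fin.ext he]
      | succ j => rw [hz, hs] at he; have := hpos j; omega
    | succ i =>
      induction k using Fin.cases with
      | zero => rw [hz, hs] at he; have := hpos i; omega
      | succ j =>
        rw [hs, hs, Nat.add_left_cancel_iff] at he
        have hij : i = j := Fin.ext (le_antisymm (not_lt.mp (hj j i r q h' h he.symm))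
          (not_lt.mp (hj i j q r h h' he)))
        subst hij
        simp [Fin.ext (Nat.add_right_cancel he)]
  have := Fintype.card_le_of_injective (fun p => (⟨g p, hlt p⟩ : Fin (2 * n - 1)))
    fun p p' h => hinj (congr_arg Fin.val h)
  rw [Fintype.card_fin] at this
  have h2 : Fintype.card (Param n) + 1 ≤ 2 * n := by omega
  have h3 : ((Fintype.card (Param n) + 1 : ℕ) : ℝ) ≤ ((2 * n : ℕ) : ℝ) := Nat.cast_le.mpr h2
  push_cast at h3
  linarith

/-! ### Uniform angles -/

/-- The uniform distribution on `[0, 2π]`. -/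
abbrev uniformAngle : Measure ℝ := cond volume (Set.Icc 0 (2 * Real.pi))

theorem volume_Icc_two_pi : volume (Set.Icc 0 (2 * Real.pi)) = ENNReal.ofReal (2 * Real.pi) := by
  rw [Real.volume_Icc, sub_zero]

instance isProbabilityMeasure_uniformAngle : IsProbabilityMeasure uniformAngle :=
  cond_isProbabilityMeasure_of_finite
    (by rw [volume_Icc_two_pi]; simp [Real.pi_pos])
    (by rw [volume_Icc_two_pi]; exact ENNReal.ofReal_ne_top)

/-- The point of `(0, 2π]` that is congruent to `t + s` modulo `2π`. -/
def wrapAdd (s t : ℝ) : ℝ :=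
  haveI : Fact (0 < 2 * Real.pi) := ⟨Real.two_pi_pos⟩
  AddCircle.equivIoc (2 * Real.pi) 0 ((t : AddCircle (2 * Real.pi)) + s)

theorem exists_wrapAdd_eq (s t : ℝ) : ∃ k : ℤ, wrapAdd s t = t + s + k * (2 * Real.pi) := by
  have : Fact (0 < 2 * Real.pi) := ⟨Real.two_pi_pos⟩
  have h : ((wrapAdd s t : ℝ) : AddCircle (2 * Real.pi)) = ((t + s : ℝ) : AddCircle (2 * Real.pi)) := by
    rw [AddCircle.coe_add]
    exact (AddCircle.equivIoc (2 * Real.pi) 0).symm_apply_apply _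
  have h0 : ((wrapAdd s t - (t + s) : ℝ) : AddCircle (2 * Real.pi)) = 0 := by
    rw [AddCircle.coe_sub, h, sub_self]
  obtain ⟨k, hk⟩ := (AddCircle.coe_eq_zero_iff _).mp h0
  rw [zsmul_eq_mul] at hk
  exact ⟨k, by linarith⟩

/-- Up to a null set, the interval is the circle of length `2π`, where translation preserves Haar
measure. -/
theorem measurePreserving_wrapAdd (s : ℝ) :
    MeasurePreserving (wrapAdd s) uniformAngle uniformAngle := by
  have : Fact (0 < 2 * Real.pi) := ⟨Real.two_pi_pos⟩
  have h : uniformAngle = (volume (Set.Icc 0 (2 * Real.pi)))⁻¹ •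
      volume.restrict (Set.Ioc 0 (0 + 2 * Real.pi)) := by
    rw [uniformAngle, ProbabilityTheory.cond, zero_add, Measure.restrict_congr_set Ioc_ae_eq_Icc]
  rw [h]
  refine MeasurePreserving.smul_measure ?_ _
  have h1 := AddCircle.measurePreserving_mk (2 * Real.pi) 0
  have h2 := measurePreserving_add_right (volume : Measure (AddCircle (2 * Real.pi))) s
  have h3 := AddCircle.measurePreserving_equivIoc (2 * Real.pi) (a := 0)
  have h4 := measurePreserving_subtype_coe (μa := (volume : Measure ℝ))
    (measurableSet_Ioc (a := 0) (b := 0 + 2 * Real.pi))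
  exact h4.comp (h3.comp (h2.comp h1))

theorem integral_uniformAngle_sq (a x z : ℝ) :
    ∫ t, (Real.cos (2 * t + a) * x + Real.sin (2 * t + a) * z) ^ 2 ∂uniformAngle =
      (x ^ 2 + z ^ 2) / 2 := by
  rw [uniformAngle, ProbabilityTheory.cond, integral_smul_measure, volume_Icc_two_pi,
    integral_Icc_eq_integral_Ioc,
    ← intervalIntegral.integral_of_le Real.two_pi_pos.le]
  -- The linear term carries the mean of the squared sinusoid; the rest is periodic and cancels over
  -- the interval, on which its argument makes four full turns.
  have hF : ∀ t ∈ Set.uIcc 0 (2 * Real.pi), HasDerivAt (fun t : ℝ => (x ^ 2 + z ^ 2) / 2 * t +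
      ((x ^ 2 - z ^ 2) / 8 * Real.sin (2 * (2 * t + a)) - x * z / 4 * Real.cos (2 * (2 * t + a))))
      ((Real.cos (2 * t + a) * x + Real.sin (2 * t + a) * z) ^ 2) t := fun t _ => by
    have h1 : HasDerivAt (fun t : ℝ => 2 * (2 * t + a)) 4 t := by
      refine ((((hasDerivAt_id t).const_mul 2).add_const a).const_mul 2).congr_deriv ?_
      norm_num
    refine HasDerivAt.congr_deriv (((hasDerivAt_id t).const_mul ((x ^ 2 + z ^ 2) / 2)).add
      ((h1.sin.const_mul ((x ^ 2 - z ^ 2) / 8)).sub (h1.cos.const_mul (x * z / 4)))) ?_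
    rw [Real.cos_two_mul', Real.sin_two_mul]
    linear_combination (-(x ^ 2 + z ^ 2) / 2) * Real.sin_sq_add_cos_sq (2 * t + a)
  rw [intervalIntegral.integral_eq_sub_of_hasDerivAt hF
    (Continuous.intervalIntegrable (by fun_prop) _ _)]
  have e : 2 * (2 * (2 * Real.pi) + a) = 2 * (2 * 0 + a) + (4 : ℕ) * (2 * Real.pi) := by
    push_cast; ring
  rw [e, Real.sin_add_nat_mul_two_pi, Real.cos_add_nat_mul_two_pi, ENNReal.toReal_inv,
    ENNReal.toReal_ofReal Real.two_pi_pos.le, smul_eq_mul]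
  have := Real.pi_ne_zero
  field_simp
  ring

theorem measurePreserving_paramLaw (n : ℕ) :
    MeasurePreserving (WithLp.toLp 2) (Measure.pi fun _ : Param n => uniformAngle) (paramLaw n) :=
  ⟨WithLp.measurable_toLp 2 _, rfl⟩

instance isProbabilityMeasure_paramLaw (n : ℕ) : IsProbabilityMeasure (paramLaw n) :=
  Measure.isProbabilityMeasure_map (WithLp.measurable_toLp 2 _).aemeasurable

theorem integral_paramLaw (h : EuclideanSpace ℝ (Param n) → ℝ) :
    ∫ θ, h θ ∂paramLaw n =
      ∫ x, h (WithLp.toLp 2 x) ∂(Measure.pi fun _ : Param n => uniformAngle) :=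
  ((measurePreserving_paramLaw n).integral_comp
    (MeasurableEquiv.toLp 2 (Param n → ℝ)).measurableEmbedding h).symm

/-- The law of the parameters is invariant under translations modulo `2π`. -/
theorem integral_paramLaw_add {h : EuclideanSpace ℝ (Param n) → ℝ} (hm : Measurable h)
    (hper : ∀ θ (k : Param n → ℤ), h (θ + WithLp.toLp 2 fun p => k p * (2 * Real.pi)) = h θ)
    (c : EuclideanSpace ℝ (Param n)) :
    ∫ θ, h (θ + c) ∂paramLaw n = ∫ θ, h θ ∂paramLaw n := by
  rw [integral_paramLaw, integral_paramLaw]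
  have hw := measurePreserving_pi (fun _ : Param n => uniformAngle) (fun _ => uniformAngle)
    fun p => measurePreserving_wrapAdd (c p)
  have hmap := integral_map (μ := Measure.pi fun _ : Param n => uniformAngle)
    (f := fun x => h (WithLp.toLp 2 x)) hw.measurable.aemeasurable
    (hm.comp (WithLp.measurable_toLp 2 _)).aestronglyMeasurable
  rw [hw.map_eq] at hmap
  rw [hmap]
  refine integral_congr_ae (Filter.Eventually.of_forall fun x => ?_)
  -- The wrapped angles differ from `x + c` by multiples of `2π`, which `h` does not see.
  choose k hk using fun p => exists_wrapAdd_eq (c p) (x p)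
  change h (WithLp.toLp 2 x + c) = h (WithLp.toLp 2 fun p => wrapAdd (c p) (x p))
  rw [← hper _ k]
  congr 1
  ext p
  simp [hk]

/-! ### The gradient -/

/-- The Riesz isometry reduces this to `fderiv`, which is measurable for every `f`. -/
theorem measurable_norm_gradient_sq (f : EuclideanSpace ℝ (Param n) → ℝ) :
    Measurable fun θ => ‖gradient f θ‖ ^ 2 := by
  simp only [gradient, LinearIsometryEquiv.norm_map]
  exact (measurable_fderiv ℝ f).norm.pow_const 2

section

variable [NeZero n]

theorem objective_add_period (ρ : Operator n) (θ : EuclideanSpace ℝ (Param n)) (k : Param n → ℤ) :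
    objective ρ (θ + WithLp.toLp 2 fun p => k p * (2 * Real.pi)) = objective ρ θ := by
  have h : circuit (θ + WithLp.toLp 2 fun p => k p * (2 * Real.pi)) = circuit θ :=
    partialCircuit_congr (fun ℓ => by
      rw [rotationLayer_eq, rotationLayer_eq]
      refine tensor_congr fun q => ?_
      by_cases hq : HasRotation n ℓ q
      · simp [rotationGate, hq, rotation_add_int_mul_two_pi]
      · simp [rotationGate, hq]) _
  rw [objective, objective, h]

theorem gradient_objective_add_period (ρ : Operator n) (θ : EuclideanSpace ℝ (Param n))
    (k : Param n → ℤ) : gradient (objective ρ) (θ + WithLp.toLp 2 fun p => k p * (2 * Real.pi)) =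
      gradient (objective ρ) θ := by
  rw [gradient, gradient, ← fderiv_comp_add_right]
  simp only [objective_add_period]

theorem norm_gradient_objective_sq_le {ρ : Operator n} (hρ : IsState ρ)
    (θ : EuclideanSpace ℝ (Param n)) : ‖gradient (objective ρ) θ‖ ^ 2 ≤ 2 * n - 1 := by
  rw [norm_gradient_sq (differentiable_objective ρ)]
  refine (Finset.sum_le_card_nsmul _ _ 1 fun p _ => ?_).trans ?_
  · rw [sq_le_one_iff_abs_le_one]
    exact abs_deriv_objective_le hρ θ p
  · rw [nsmul_one]
    exact card_param_le

theorem integrable_norm_gradient_objective_sq {ρ : Operator n} (hρ : IsState ρ) :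
    Integrable (fun θ => ‖gradient (objective ρ) θ‖ ^ 2) (paramLaw n) :=
  Integrable.of_bound (measurable_norm_gradient_sq _).aestronglyMeasurable (2 * n - 1)
    (Filter.Eventually.of_forall fun θ => by
      rw [Real.norm_of_nonneg (sq_nonneg _)]
      exact norm_gradient_objective_sq_le hρ θ)

/-! ### The mean field -/

/-- The factors of the mean field, one for each angle. -/
def meanFactor (x z : ℝ) (p : Param n) (t : ℝ) : ℝ :=
  if p.1.2 = 0 then
    if p.1.1 = 0 then Real.cos (2 * t + phase n 0) * x + Real.sin (2 * t + phase n 0) * z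
    else Real.cos (2 * t + phase n p.1.1)
  else 1

/-- A product with one factor per angle, so that its mean square factorizes under the product
measure. -/
theorem meanField_eq_prod (x z : ℝ) (θ : EuclideanSpace ℝ (Param n)) :
    meanField x z θ = ∏ p, meanFactor x z p (θ p) := by
  rw [← Fintype.prod_of_injective (headParam n) headParam_injective
    (fun k => meanFactor x z (headParam n k) (θ (headParam n k))) _ ?_ fun _ => rfl]
  · rw [← Finset.mul_prod_erase _ _ (Finset.mem_univ 0), mul_comm, meanField]
    have h : Finset.univ.erase 0 = Finset.Ioc 0 (Fin.last (depth n)) := by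
      ext k
      simp [Fin.le_last, Fin.pos_iff_ne_zero]
    rw [h]
    congr 1
    refine Finset.prod_congr rfl fun k hk => ?_
    simp [meanFactor, headParam, (Finset.mem_Ioc.mp hk).1.ne']
  · intro p hp
    refine if_neg fun h0 => hp ⟨p.1.1, ?_⟩
    exact Subtype.ext (Prod.ext rfl h0.symm)

/-- A sinusoid of period `π` is determined by its values at two points a quarter period apart. -/
theorem meanFactor_add (x z : ℝ) (k : Fin (depth n + 1)) (s t : ℝ) :
    meanFactor x z (headParam n k) (s + t) = Real.cos (2 * t) * meanFactor x z (headParam n k) s +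
      Real.sin (2 * t) * meanFactor x z (headParam n k) (s + Real.pi / 4) := by
  have e1 : ∀ a, 2 * (s + t) + a = 2 * s + a + 2 * t := fun a => by ring
  have e2 : ∀ a, 2 * (s + Real.pi / 4) + a = 2 * s + a + Real.pi / 2 := fun a => by ring
  simp only [meanFactor, headParam, if_true, e1, e2]
  by_cases hk : k = 0
  · simp only [hk, if_true]
    rw [Real.cos_add (_ + _) (2 * t), Real.sin_add (_ + _) (2 * t), Real.cos_add_pi_div_two,
      Real.sin_add_pi_div_two]
    ring
  · simp only [hk, if_false]
    rw [Real.cos_add (_ + _) (2 * t), Real.cos_add_pi_div_two]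
    ring

theorem meanField_add_single (x z : ℝ) (θ : EuclideanSpace ℝ (Param n)) (k : Fin (depth n + 1))
    (t : ℝ) : meanField x z (θ + EuclideanSpace.single (headParam n k) t) =
      Real.cos (2 * t) * meanField x z θ + Real.sin (2 * t) *
        meanField x z (θ + EuclideanSpace.single (headParam n k) (Real.pi / 4)) := by
  have h : ∀ r, meanField x z (θ + EuclideanSpace.single (headParam n k) r) =
      meanFactor x z (headParam n k) (θ (headParam n k) + r) *
        ∏ p ∈ Finset.univ.erase (headParam n k), meanFactor x z p (θ p) := fun r => by
    rw [meanField_eq_prod, ← Finset.mul_prod_erase _ _ (Finset.mem_univ (headParam n k))]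
    congr 1
    · simp
    · refine Finset.prod_congr rfl fun p hp => ?_
      simp [Finset.ne_of_mem_erase hp]
  have h0 := h 0
  rw [single_zero, add_zero, add_zero] at h0
  rw [h, h, h0, meanFactor_add]
  ring

/-- Differentiating a sinusoid is a quarter-period shift times the frequency, so the squared partial
derivatives are again squared mean fields. -/
theorem hasDerivAt_meanField (x z : ℝ) (θ : EuclideanSpace ℝ (Param n)) (k : Fin (depth n + 1)) :
    HasDerivAt (fun t => meanField x z (θ + EuclideanSpace.single (headParam n k) t))
      (2 * meanField x z (θ + EuclideanSpace.single (headParam n k) (Real.pi / 4))) 0 := by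
  rw [funext (meanField_add_single x z θ k)]
  have h2 : HasDerivAt (fun t : ℝ => 2 * t) 2 0 := by simpa using (hasDerivAt_id (0 : ℝ)).const_mul 2
  refine ((h2.cos.mul_const _).add (h2.sin.mul_const _)).congr_deriv ?_
  rw [mul_zero, Real.sin_zero, Real.cos_zero]; ring

/-- By independence: the `depth n` cosine factors have mean square `1 / 2`, the factor of layer `0`
has `(x ^ 2 + z ^ 2) / 2`, and the other angles contribute `1`. -/
theorem integral_meanField_add_sq (x z : ℝ) (c : EuclideanSpace ℝ (Param n)) :
    ∫ θ, meanField x z (θ + c) ^ 2 ∂paramLaw n = (1 / 2) ^ (depth n + 1) * (x ^ 2 + z ^ 2) := by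
  rw [integral_paramLaw]
  simp only [meanField_eq_prod, ← Finset.prod_pow, PiLp.add_apply]
  rw [integral_fintype_prod_eq_prod (fun p t => meanFactor x z p (t + c p) ^ 2)]
  have e : ∀ t b a : ℝ, 2 * (t + b) + a = 2 * t + (2 * b + a) := fun _ _ _ => by ring
  have hcos : ∀ a, ∫ t, Real.cos (2 * t + a) ^ 2 ∂uniformAngle = 1 / 2 := fun a => by
    simpa using integral_uniformAngle_sq a 1 0
  rw [← Fintype.prod_of_injective (headParam n) headParam_injective
    (fun k => if k = 0 then (x ^ 2 + z ^ 2) / 2 else 1 / 2)]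
  · rw [Fin.prod_univ_succ, if_pos rfl]
    simp only [Fin.succ_ne_zero, if_false, Finset.prod_const, Finset.card_univ, Fintype.card_fin]
    rw [pow_succ]
    ring
  · intro p hp
    have h : p.1.2 ≠ 0 := fun h0 => hp ⟨p.1.1, Subtype.ext (Prod.ext rfl h0.symm)⟩
    simp [meanFactor, h]
  · intro k
    by_cases hk : k = 0
    · simp [meanFactor, headParam, hk, e, integral_uniformAngle_sq]
    · simp only [meanFactor, headParam, hk, e, hcos, if_true, if_false]

theorem integrable_meanField_add_sq (x z : ℝ) (c : EuclideanSpace ℝ (Param n)) :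
    Integrable (fun θ => meanField x z (θ + c) ^ 2) (paramLaw n) := by
  have hc : Continuous fun θ : EuclideanSpace ℝ (Param n) => meanField x z (θ + c) ^ 2 := by
    unfold meanField
    fun_prop
  refine Integrable.of_bound hc.aestronglyMeasurable ((|x| + |z|) ^ 2)
    (Filter.Eventually.of_forall fun θ => ?_)
  rw [norm_pow, Real.norm_eq_abs, meanField, abs_mul, Finset.abs_prod]
  refine pow_le_pow_left₀ (by positivity) ?_ 2
  have h1 : ∏ k ∈ Finset.Ioc 0 (Fin.last (depth n)),
      |Real.cos (2 * (θ + c) (headParam n k) + phase n k)| ≤ 1 :=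
    Finset.prod_le_one (fun _ _ => abs_nonneg _) fun _ _ => Real.abs_cos_le_one _
  have h2 : ∀ φ : ℝ, |Real.cos φ * x + Real.sin φ * z| ≤ |x| + |z| := fun φ => by
    refine (abs_add_le _ _).trans (add_le_add ?_ ?_) <;> rw [abs_mul]
    · exact mul_le_of_le_one_left (abs_nonneg _) (Real.abs_cos_le_one _)
    · exact mul_le_of_le_one_left (abs_nonneg _) (Real.abs_sin_le_one _)
  exact (mul_le_of_le_one_left (abs_nonneg _) h1).trans (h2 _)

/-- By convexity, averaging the objective function does not increase the gradient. -/
theorem sum_meanField_sq_le (ρ : Operator n) (θ : EuclideanSpace ℝ (Param n)) :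
    ∑ k : Fin (depth n + 1),
      meanField (pauliString (Pi.single (0 : Fin n) 1) * ρ).trace.re
        (pauliString (Pi.single (0 : Fin n) 3) * ρ).trace.re
        (θ + EuclideanSpace.single (headParam n k) (Real.pi / 4)) ^ 2 ≤
      (2 ^ n)⁻¹ * ∑ s : Fin n → Fin 2, ‖gradient (objective ρ) (θ + quarterShift s)‖ ^ 2 := by
  set x := (pauliString (Pi.single (0 : Fin n) 1) * ρ).trace.re
  set z := (pauliString (Pi.single (0 : Fin n) 3) * ρ).trace.re
  set D : (Fin n → Fin 2) → Param n → ℝ := fun s p =>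
    deriv (fun t => objective ρ (θ + quarterShift s + EuclideanSpace.single p t)) 0 with hD
  have h2 : (0 : ℝ) < 2 ^ n := by positivity
  have hcard : ((Finset.univ : Finset (Fin n → Fin 2)).card : ℝ) = 2 ^ n := by simp
  -- The identity `sum_objective_add_quarterShift` is differentiated in one angle of qubit `0`; its
  -- factor `1 / 2` cancels the frequency `2`.
  have hderiv : ∀ k, ∑ s, D s (headParam n k) = 2 ^ n *
      meanField x z (θ + EuclideanSpace.single (headParam n k) (Real.pi / 4)) := fun k => by
    have hs : ∀ s : Fin n → Fin 2, HasDerivAt (fun t => objective ρ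
        (θ + quarterShift s + EuclideanSpace.single (headParam n k) t))
        (D s (headParam n k)) 0 := fun s => by
      obtain ⟨a, b, c, h⟩ := exists_objective_add_single_eq ρ (θ + quarterShift s) (headParam n k)
      refine DifferentiableAt.hasDerivAt ?_
      rw [funext h]
      fun_prop
    have h3 := HasDerivAt.fun_sum (u := Finset.univ) fun s _ => hs s
    have h4 := (((hasDerivAt_meanField x z θ k).const_mul (1 / 2)).const_add (1 / 2)).const_mul
      ((2 : ℝ) ^ n)
    have h5 : (fun t => ∑ s : Fin n → Fin 2, objective ρ
        (θ + quarterShift s + EuclideanSpace.single (headParam n k) t)) = fun t =>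
        2 ^ n * (1 / 2 + 1 / 2 *
          meanField x z (θ + EuclideanSpace.single (headParam n k) t)) := by
      funext t
      rw [← sum_objective_add_quarterShift]
      exact Finset.sum_congr rfl fun s _ => by rw [add_right_comm]
    rw [h5] at h3
    rw [h3.unique h4]
    ring
  calc ∑ k, meanField x z (θ + EuclideanSpace.single (headParam n k) (Real.pi / 4)) ^ 2
      = ∑ k, ((2 ^ n)⁻¹ * ∑ s, D s (headParam n k)) ^ 2 :=
        Finset.sum_congr rfl fun k _ => by rw [hderiv, inv_mul_cancel_left₀ h2.ne']
    -- Cauchy–Schwarz for the average over the `2 ^ n` shifts.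
    _ ≤ ∑ k, (2 ^ n)⁻¹ * ∑ s, D s (headParam n k) ^ 2 := Finset.sum_le_sum fun k _ => by
        have := sq_sum_le_card_mul_sum_sq (s := Finset.univ) (f := fun s => D s (headParam n k))
        rw [hcard] at this
        rw [mul_pow, sq ((2 ^ n : ℝ)⁻¹), mul_assoc]
        refine mul_le_mul_of_nonneg_left ?_ (inv_nonneg.mpr h2.le)
        rwa [inv_mul_le_iff₀ h2]
    _ = (2 ^ n)⁻¹ * ∑ s, ∑ k, D s (headParam n k) ^ 2 := by
        rw [← Finset.mul_sum, Finset.sum_comm]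
    -- The partial derivatives in angles away from qubit `0` are added; they only increase the sum.
    _ ≤ (2 ^ n)⁻¹ * ∑ s, ‖gradient (objective ρ) (θ + quarterShift s)‖ ^ 2 := by
        refine mul_le_mul_of_nonneg_left (Finset.sum_le_sum fun s _ => ?_) (inv_nonneg.mpr h2.le)
        rw [norm_gradient_sq (differentiable_objective ρ)]
        have := Finset.sum_map Finset.univ ⟨headParam n, headParam_injective⟩ fun p => D s p ^ 2
        simp only [Function.Embedding.coeFn_mk] at this
        rw [← this]
        exact Finset.sum_le_sum_of_subset_of_nonneg (Finset.subset_univ _) fun _ _ _ => sq_nonneg _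

/-! ### The expected squared gradient and the final constants -/

/-- Integrating `sum_meanField_sq_le`: by periodicity every quarter shift has the same integral, and
the `depth n + 1` mean fields have equal mean squares. -/
theorem le_integral_norm_gradient_objective_sq {ρ : Operator n} (hρ : IsState ρ) :
    (depth n + 1) * (1 / 2) ^ (depth n + 1) * alpha ρ ≤
      ∫ θ, ‖gradient (objective ρ) θ‖ ^ 2 ∂paramLaw n := by
  have hper : ∀ s : Fin n → Fin 2,
      ∫ θ, ‖gradient (objective ρ) (θ + quarterShift s)‖ ^ 2 ∂paramLaw n =
        ∫ θ, ‖gradient (objective ρ) θ‖ ^ 2 ∂paramLaw n := fun s =>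
    integral_paramLaw_add (measurable_norm_gradient_sq _)
      (fun θ k => by rw [gradient_objective_add_period]) _
  have hint : ∀ s : Fin n → Fin 2,
      Integrable (fun θ => ‖gradient (objective ρ) (θ + quarterShift s)‖ ^ 2) (paramLaw n) :=
    fun s => Integrable.of_bound
      ((measurable_norm_gradient_sq (objective ρ)).comp
        (measurable_add_const (quarterShift s))).aestronglyMeasurable (2 * n - 1)
      (Filter.Eventually.of_forall fun θ => by
        rw [Real.norm_of_nonneg (sq_nonneg _)]
        exact norm_gradient_objective_sq_le hρ _)
  have h := integral_mono
    (integrable_finsetSum Finset.univ fun k _ => integrable_meanField_add_sq _ _ _)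
    ((integrable_finsetSum Finset.univ fun s _ => hint s).const_mul ((2 ^ n)⁻¹))
    (sum_meanField_sq_le ρ)
  rw [integral_finsetSum _ fun k _ => integrable_meanField_add_sq _ _ _, integral_const_mul,
    integral_finsetSum _ fun s _ => hint s] at h
  simp only [integral_meanField_add_sq, hper, Finset.sum_const, Finset.card_univ, Fintype.card_fin,
    Fintype.card_fun, nsmul_eq_mul] at h
  have h2 : (2 : ℝ) ^ n ≠ 0 := by positivity
  push_cast at h
  rw [inv_mul_cancel_left₀ h2, ← mul_assoc] at h
  exact h

theorem alpha_nonneg (ρ : Operator n) : 0 ≤ alpha ρ := add_nonneg (sq_nonneg _) (sq_nonneg _)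

theorem one_add_logb_div_le :
    (1 + Real.logb 2 n) / (4 * n) ≤ (depth n + 1) * (1 / 2) ^ (depth n + 1) := by
  have hn : 0 < n := Nat.pos_of_neZero n
  have hn' : (0 : ℝ) < n := Nat.cast_pos.mpr hn
  have h1 : Real.logb 2 n ≤ depth n := by
    rw [Real.logb_le_iff_le_rpow one_lt_two hn', Real.rpow_natCast]
    exact_mod_cast Nat.le_pow_clog one_lt_two n
  have h2 : (2 : ℝ) ^ (depth n + 1) ≤ 4 * n := by
    have : 2 ^ (depth n + 1) ≤ 4 * n := by
      -- Minimality of `depth n` gives `2 ^ (depth n - 1) < n` only for positive depth; depth `0`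
      -- needs just `2 ≤ 4 * n`.
      rcases Nat.eq_zero_or_pos (depth n) with h | h
      · rw [h]; omega
      · have := (Nat.lt_clog_iff_pow_lt one_lt_two).mp (Nat.sub_lt h one_pos)
        have e : depth n + 1 = depth n - 1 + 2 := by omega
        rw [e, pow_add]
        change 2 ^ (depth n - 1) < n at this
        omega
    exact_mod_cast this
  rw [one_div, inv_pow, ← div_eq_mul_inv]
  exact div_le_div₀ (by positivity) (by linarith) (by positivity) h2

end

end DTTQNN

end

theorem mainTheorem3 (n : ℕ) [NeZero n] (ρ : DTTQNN.Operator n) (hρ : DTTQNN.IsState ρ) :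
    Differentiable ℝ (DTTQNN.objective ρ) ∧
    MeasureTheory.Integrable (fun θ => ‖gradient (DTTQNN.objective ρ) θ‖ ^ 2)
      (DTTQNN.paramLaw n) ∧
    (1 + Real.logb 2 n) / (4 * n) * DTTQNN.alpha ρ ≤
      ∫ θ, ‖gradient (DTTQNN.objective ρ) θ‖ ^ 2 ∂(DTTQNN.paramLaw n) ∧
    ∫ θ, ‖gradient (DTTQNN.objective ρ) θ‖ ^ 2 ∂(DTTQNN.paramLaw n) ≤ 2 * (n : ℝ) - 1 := by
  refine ⟨DTTQNN.differentiable_objective ρ, DTTQNN.integrable_norm_gradient_objective_sq hρ,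
    (mul_le_mul_of_nonneg_right DTTQNN.one_add_logb_div_le (DTTQNN.alpha_nonneg ρ)).trans
      (DTTQNN.le_integral_norm_gradient_objective_sq hρ), ?_⟩
  have h := MeasureTheory.integral_mono (DTTQNN.integrable_norm_gradient_objective_sq hρ)
    (MeasureTheory.integrable_const (2 * (n : ℝ) - 1))
    (DTTQNN.norm_gradient_objective_sq_le hρ)
  simpa using h
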